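/- Let $\mathbb K$ be $\mathbb R$ or $\mathbb C$; all Banach spaces are over $\mathbb K$ and $\cong$ means linear homeomorphism. For Banach spaces $E,F$ let $\mathrm{Ext}^1(F,E)$ be the set of congruence classes of short exact sequences $0\to E\xrightarrow{i}G\xrightarrow{\sigma}F\to0$ with $G$ a Banach space and $i,\sigma$ bounded linear operators. Two such sequences, with middle spaces $G_1,G_2$, are congruent if there is an isomorphism $h:G_1\to G_2$ with $hi_1=i_2$ and $\sigma_2h=\sigma_1$. It is a $\mathbb K$-vector space: the sum of two classes is the Baer sum $\nabla(\alpha_1\oplus\alpha_2)\Delta$ (push-out along $\nabla(x,y)=x+y$, pull-back along $\Delta y=(y,y)$), $\lambda\alpha$ is the push-out of $\alpha$ along $\lambda I_E$, and $0$ is the class of the split extension. A Banach space $X$ is an $\mathcal L_2$-space if there is $C$ such that every finite-dimensional subspace of $X$ is contained in a finite-dimensional subspace $B\subset X$ admitting an isomorphism $T:B\to\ell_2^n$, $n=\dim B$, with $\|T\|\,\|T^{-1}\|\le C$. $X$ has the approximation property (AP) if for every compact $K\subset X$ there is a sequence of bounded finite-rank operators on $X$ converging to the identity uniformly on $K$;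 it has the bounded approximation property (BAP) if there is a norm-bounded net of finite-rank operators on $X$ converging to the identity uniformly on every compact set. **Theorem.** Let $E$ and $F$ be infinite-dimensional $\mathcal L_2$-spaces satisfying at least one of the following conditions: 1. $E$ is reflexive and has the AP; 2. $F$ has the BAP, and $E$ or $F$ is isomorphic to the dual of a Banach space; 3. $E\oplus E\cong E$ or $F\oplus F\cong F$. Then $\dim\mathrm{Ext}^1(F,E)=\infty$. In particular, if $E\cong F\cong\ell_2$, then $E$ and $F$ are infinite-dimensional $\mathcal L_2$-spaces satisfying at least one of these conditions, and $\dim\mathrm{Ext}^1(F,E)=\infty$. -/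

import Mathlib

open Filter Topology
open scoped ENNReal

universe u v

section Extensions

/-- A short exact sequence `0 → E → G → F → 0` of Banach spaces and bounded operators.  The middle
space has the cardinality of `E × F`, so the universe `max u v` loses no extension. -/
structure BanachExtension (𝕜 : Type*) [RCLike 𝕜]
    (F : Type v) [NormedAddCommGroup F] [NormedSpace 𝕜 F]
    (E : Type u) [NormedAddCommGroup E] [NormedSpace 𝕜 E] where
  G : Type (max u v)
  [normedAddCommGroup : NormedAddCommGroup G]
  [normedSpace : NormedSpace 𝕜 G]
  [completeSpace : CompleteSpace G]
  i : E →L[𝕜] G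
  σ : G →L[𝕜] F
  injective_i : Function.Injective i
  surjective_σ : Function.Surjective σ
  exact : ∀ g : G, σ g = 0 ↔ ∃ e : E, i e = g

attribute [instance] BanachExtension.normedAddCommGroup BanachExtension.normedSpace
  BanachExtension.completeSpace

namespace BanachExtension

variable {𝕜 : Type*} [RCLike 𝕜]
  {F : Type v} [NormedAddCommGroup F] [NormedSpace 𝕜 F]
  {E : Type u} [NormedAddCommGroup E] [NormedSpace 𝕜 E]
  {E' : Type u} [NormedAddCommGroup E'] [NormedSpace 𝕜 E']
  {F' : Type v} [NormedAddCommGroup F'] [NormedSpace 𝕜 F']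

/-- Two extensions are congruent if there is an isomorphism `h` of the middle spaces compatible with
the identity operators of `E` and `F`. -/
def Congruent (X Y : BanachExtension 𝕜 F E) : Prop :=
  ∃ h : X.G ≃L[𝕜] Y.G, (∀ e, h (X.i e) = Y.i e) ∧ ∀ g, Y.σ (h g) = X.σ g

instance setoid (𝕜 : Type*) [RCLike 𝕜]
    (F : Type v) [NormedAddCommGroup F] [NormedSpace 𝕜 F]
    (E : Type u) [NormedAddCommGroup E] [NormedSpace 𝕜 E] :
    Setoid (BanachExtension 𝕜 F E) where
  r := Congruent
  iseqv :=
    { refl := fun X => ⟨ContinuousLinearEquiv.refl 𝕜 X.G, fun _ => rfl, fun _ => rfl⟩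
      symm := by
        rintro X Y ⟨h, hi, hσ⟩
        refine ⟨h.symm, fun e => ?_, fun g => ?_⟩
        · rw [← hi e, h.symm_apply_apply]
        · rw [← hσ, h.apply_symm_apply]
      trans := by
        rintro X Y Z ⟨h, hi, hσ⟩ ⟨k, ki, kσ⟩
        refine ⟨h.trans k, fun e => ?_, fun g => ?_⟩
        · simp [hi, ki]
        · simp [hσ, kσ] }

lemma σ_i (X : BanachExtension 𝕜 F E) (e : E) : X.σ (X.i e) = 0 := (X.exact _).2 ⟨e, rfl⟩

lemma exists_norm_le [CompleteSpace E] (X : BanachExtension 𝕜 F E) :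
    ∃ K : NNReal, ∀ e, ‖e‖ ≤ K * ‖X.i e‖ := by
  have hcl : IsClosed (Set.range X.i) := by
    have : Set.range X.i = X.σ ⁻¹' {0} := by
      ext g
      simp [X.exact g]
    rw [this]
    exact isClosed_singleton.preimage X.σ.continuous
  obtain ⟨K, hK⟩ :=
    X.i.antilipschitz_of_injective_of_isClosed_range X.injective_i hcl
  exact ⟨K, fun e => X.i.bound_of_antilipschitz hK e⟩

/-- The split extension `0 → E → E ⊕ F → F → 0`. -/
def split (𝕜 : Type*) [RCLike 𝕜]
    (F : Type v) [NormedAddCommGroup F] [NormedSpace 𝕜 F] [CompleteSpace F]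
    (E : Type u) [NormedAddCommGroup E] [NormedSpace 𝕜 E] [CompleteSpace E] :
    BanachExtension 𝕜 F E where
  G := E × F
  i := ContinuousLinearMap.inl 𝕜 E F
  σ := ContinuousLinearMap.snd 𝕜 E F
  injective_i := fun a b h => by simpa using congrArg Prod.fst h
  surjective_σ := fun y => ⟨(0, y), rfl⟩
  exact := by
    rintro ⟨a, b⟩
    simp [eq_comm]

/-- The direct sum `0 → E ⊕ E' → G ⊕ G' → F ⊕ F' → 0` of two extensions. -/
def directSum (X : BanachExtension 𝕜 F E) (Y : BanachExtension 𝕜 F' E') :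
    BanachExtension 𝕜 (F × F') (E × E') where
  G := X.G × Y.G
  i := X.i.prodMap Y.i
  σ := X.σ.prodMap Y.σ
  injective_i := X.injective_i.prodMap Y.injective_i
  surjective_σ := X.surjective_σ.prodMap Y.surjective_σ
  exact := by
    rintro ⟨a, b⟩
    simp [Prod.ext_iff, X.exact, Y.exact]

/-- The subspace `{(i e, -T e)}` of `G ⊕ E'`. -/
def pushoutSubmodule (T : E →L[𝕜] E') (X : BanachExtension 𝕜 F E) : Submodule 𝕜 (X.G × E') :=
  LinearMap.range (X.i.prod (-T)).toLinearMap

lemma mem_pushoutSubmodule (T : E →L[𝕜] E') (X : BanachExtension 𝕜 F E) (p : X.G × E') :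
    p ∈ pushoutSubmodule T X ↔ ∃ e, X.i e = p.1 ∧ -T e = p.2 := by
  simp [pushoutSubmodule, LinearMap.mem_range, Prod.ext_iff]

lemma isClosed_pushoutSubmodule [CompleteSpace E] (T : E →L[𝕜] E') (X : BanachExtension 𝕜 F E) :
    IsClosed (pushoutSubmodule T X : Set (X.G × E')) := by
  obtain ⟨K, hK⟩ := X.exists_norm_le
  have h : AntilipschitzWith K (X.i.prod (-T)) := by
    refine ContinuousLinearMap.antilipschitz_of_bound _ fun e => (hK e).trans ?_
    gcongr
    exact norm_fst_le ((X.i.prod (-T)) e)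
  exact h.isClosed_range (X.i.prod (-T)).uniformContinuous

/-- The extension `T α` with middle space the quotient `(G ⊕ E') / {(i e, -T e)}`. -/
noncomputable def pushout [CompleteSpace E] [CompleteSpace E'] (T : E →L[𝕜] E')
    (X : BanachExtension 𝕜 F E) : BanachExtension 𝕜 F E' :=
  haveI := isClosed_pushoutSubmodule T X
  { G := (X.G × E') ⧸ pushoutSubmodule T X
    i := (pushoutSubmodule T X).mkQL.comp (ContinuousLinearMap.inr 𝕜 X.G E')
    σ := (pushoutSubmodule T X).liftQL (X.σ.comp (ContinuousLinearMap.fst 𝕜 X.G E')) (by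
      intro p hp
      obtain ⟨e, he, -⟩ := (mem_pushoutSubmodule T X p).1 hp
      simp [← he, σ_i])
    injective_i := by
      intro a b h
      have h' : ((0 : X.G), a) - (0, b) ∈ pushoutSubmodule T X :=
        (Submodule.Quotient.eq _).1 h
      obtain ⟨e, he, he'⟩ := (mem_pushoutSubmodule T X _).1 h'
      have h0 : e = 0 := X.injective_i (by simpa using he)
      subst h0
      simpa [sub_eq_zero, eq_comm] using he'
    surjective_σ := by
      intro y
      obtain ⟨g, hg⟩ := X.surjective_σ y
      exact ⟨Submodule.Quotient.mk (g, 0), hg⟩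
    exact := by
      intro q
      obtain ⟨⟨g, x⟩, rfl⟩ := Submodule.Quotient.mk_surjective _ q
      change X.σ g = 0 ↔ ∃ e : E', Submodule.Quotient.mk ((0 : X.G), e) = Submodule.Quotient.mk (g, x)
      constructor
      · intro hg
        obtain ⟨e, rfl⟩ := (X.exact g).1 hg
        refine ⟨x + T e, (Submodule.Quotient.eq _).2 ?_⟩
        exact (mem_pushoutSubmodule T X _).2 ⟨-e, by simp, by simp⟩
      · rintro ⟨a, ha⟩
        obtain ⟨e, he, -⟩ := (mem_pushoutSubmodule T X _).1 ((Submodule.Quotient.eq _).1 ha)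
        have : X.σ (-g) = 0 := by
          rw [← σ_i X e, he]
          simp
        simpa using this }

/-- The subspace `{(g, x) | σ g = S x}` of `G ⊕ F'`. -/
def pullbackSubmodule (S : F' →L[𝕜] F) (X : BanachExtension 𝕜 F E) : Submodule 𝕜 (X.G × F') where
  carrier := {p | X.σ p.1 = S p.2}
  add_mem' := by
    intro a b ha hb
    simp only [Set.mem_ofPred_eq] at ha hb
    simp [ha, hb]
  zero_mem' := by simp
  smul_mem' := by
    intro c a ha
    simp only [Set.mem_ofPred_eq] at ha
    simp [ha]

lemma isClosed_pullbackSubmodule (S : F' →L[𝕜] F) (X : BanachExtension 𝕜 F E) :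
    IsClosed (pullbackSubmodule S X : Set (X.G × F')) :=
  isClosed_eq (X.σ.continuous.comp continuous_fst) (S.continuous.comp continuous_snd)

/-- The extension `α S` with middle space `{(g, x) ∈ G ⊕ F' | σ g = S x}`. -/
def pullback [CompleteSpace F'] (S : F' →L[𝕜] F) (X : BanachExtension 𝕜 F E) :
    BanachExtension 𝕜 F' E where
  G := pullbackSubmodule S X
  completeSpace := (isClosed_pullbackSubmodule S X).completeSpace_coe
  i := ((ContinuousLinearMap.inl 𝕜 X.G F').comp X.i).codRestrict (pullbackSubmodule S X)
    fun e => by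
      change X.σ (X.i e) = S 0
      rw [σ_i, map_zero]
  σ := (ContinuousLinearMap.snd 𝕜 X.G F').comp (pullbackSubmodule S X).subtypeL
  injective_i := by
    intro a b h
    exact X.injective_i (congrArg (fun p : pullbackSubmodule S X => (p : X.G × F').1) h)
  surjective_σ := by
    intro x
    obtain ⟨g, hg⟩ := X.surjective_σ (S x)
    exact ⟨⟨(g, x), hg⟩, rfl⟩
  exact := by
    rintro ⟨⟨g, x⟩, hg⟩
    change x = 0 ↔ _
    have hg' : X.σ g = S x := hg
    constructor
    · rintro rfl
      rw [map_zero] at hg'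
      obtain ⟨e, he⟩ := (X.exact g).1 hg'
      exact ⟨e, Subtype.ext (Prod.ext he rfl)⟩
    · rintro ⟨e, he⟩
      exact (congrArg (fun p : pullbackSubmodule S X => (p : X.G × F').2) he).symm

/-- The Baer sum `∇ (α ⊕ β) Δ`, where `∇ (x, y) = x + y` and `Δ y = (y, y)`. -/
noncomputable def baerSum [CompleteSpace E] [CompleteSpace F] (X Y : BanachExtension 𝕜 F E) :
    BanachExtension 𝕜 F E :=
  ((directSum X Y).pushout
      (ContinuousLinearMap.fst 𝕜 E E + ContinuousLinearMap.snd 𝕜 E E)).pullback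
    ((ContinuousLinearMap.id 𝕜 F).prod (ContinuousLinearMap.id 𝕜 F))

/-! The operations respect congruence and satisfy the vector space axioms.  For the proof, an
extension is compared with the map `f : F → E` with `i ∘ f = b - s`, where `b` is a bounded section
of `σ` and `s` a linear one. -/

/-- The maps `F → E` that are the sum of a linear map and a bounded map. -/
def trivialTwists (𝕜 : Type*) [RCLike 𝕜]
    (F : Type v) [NormedAddCommGroup F] [NormedSpace 𝕜 F]
    (E : Type u) [NormedAddCommGroup E] [NormedSpace 𝕜 E] : Submodule 𝕜 (F → E) where
  carrier := {f | ∃ l : F →ₗ[𝕜] E, ∃ C : ℝ, ∀ y, ‖f y - l y‖ ≤ C * ‖y‖}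
  add_mem' := by
    rintro f g ⟨l, C, h⟩ ⟨m, D, k⟩
    refine ⟨l + m, C + D, fun y => ?_⟩
    have : (f + g) y - (l + m) y = (f y - l y) + (g y - m y) := by
      simp only [Pi.add_apply, LinearMap.add_apply]
      abel
    rw [this, add_mul]
    exact norm_add_le_of_le (h y) (k y)
  zero_mem' := ⟨0, 0, by simp⟩
  smul_mem' := by
    rintro c f ⟨l, C, h⟩
    refine ⟨c • l, ‖c‖ * C, fun y => ?_⟩
    have : (c • f) y - (c • l) y = c • (f y - l y) := by
      simp [smul_sub]
    rw [this, norm_smul, mul_assoc]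
    exact mul_le_mul_of_nonneg_left (h y) (norm_nonneg c)

def IsTwist (X : BanachExtension 𝕜 F E) (f : F → E) : Prop :=
  ∃ (s : F →ₗ[𝕜] X.G) (b : F → X.G) (C : ℝ), (∀ y, X.σ (s y) = y) ∧ (∀ y, X.σ (b y) = y) ∧
    (∀ y, ‖b y‖ ≤ C * ‖y‖) ∧ ∀ y, X.i (f y) = b y - s y

lemma exists_isTwist [CompleteSpace F] (X : BanachExtension 𝕜 F E) : ∃ f, IsTwist X f := by
  obtain ⟨s, hs⟩ := X.σ.toLinearMap.exists_rightInverse_of_surjective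
    (LinearMap.range_eq_top.2 X.surjective_σ)
  obtain ⟨C, -, hC⟩ := X.σ.exists_preimage_norm_le X.surjective_σ
  choose b hb hb' using hC
  have hs' : ∀ y, X.σ (s y) = y := fun y => LinearMap.congr_fun hs y
  have : ∀ y, ∃ e, X.i e = b y - s y := fun y => (X.exact _).1 (by rw [map_sub, hb, hs', sub_self])
  choose f hf using this
  exact ⟨f, s, b, C, hs', hb, hb', hf⟩

lemma exists_lift {V : Type*} [AddCommGroup V] [Module 𝕜 V] (X : BanachExtension 𝕜 F E)
    (m : V →ₗ[𝕜] X.G) (hm : ∀ x, X.σ (m x) = 0) : ∃ l : V →ₗ[𝕜] E, ∀ x, X.i (l x) = m x := by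
  choose l hl using fun x => (X.exact (m x)).1 (hm x)
  exact ⟨{ toFun := l
           map_add' := fun x y => X.injective_i (by simp [hl])
           map_smul' := fun c x => X.injective_i (by simp [hl]) }, hl⟩

lemma congruent_iff [CompleteSpace E] {X Y : BanachExtension 𝕜 F E} {f g : F → E}
    (hX : IsTwist X f) (hY : IsTwist Y g) : Congruent X Y ↔ f - g ∈ trivialTwists 𝕜 F E := by
  obtain ⟨s, b, C, hs, hb, hC, hf⟩ := hX
  obtain ⟨s', b', C', hs', hb', hC', hg⟩ := hY
  constructor
  · rintro ⟨h, hi, hσ⟩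
    obtain ⟨l, hl⟩ := Y.exists_lift (s' - h.toLinearMap ∘ₗ s) (by
      intro y
      simp [hs', hσ, hs])
    obtain ⟨K, hK⟩ := Y.exists_norm_le
    refine ⟨l, K * (‖(h : X.G →L[𝕜] Y.G)‖ * C + C'), fun y => (hK _).trans ?_⟩
    have e : Y.i ((f - g) y - l y) = h (b y) - b' y := by
      rw [map_sub, hl, Pi.sub_apply, map_sub, hg, ← hi, hf]
      simp only [map_sub, LinearMap.sub_apply, LinearMap.comp_apply]
      change _ - (s' y - h (s y)) = _
      abel
    rw [e, mul_assoc, add_mul]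
    refine mul_le_mul_of_nonneg_left (norm_sub_le_of_le ?_ (hC' y)) K.2
    rw [mul_assoc]
    exact ((h : X.G →L[𝕜] Y.G).le_opNorm (b y)).trans
      (mul_le_mul_of_nonneg_left (hC y) (norm_nonneg _))
  · rintro ⟨l, D, hD⟩
    obtain ⟨p, hp⟩ := X.exists_lift (LinearMap.id - s ∘ₗ X.σ.toLinearMap) (by
      intro x
      simp [hs])
    have hp' : ∀ x, X.i (p x) = x - s (X.σ x) := hp
    obtain ⟨K, hK⟩ := X.exists_norm_le
    let h₀ : X.G →ₗ[𝕜] Y.G :=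
      s' ∘ₗ X.σ.toLinearMap - Y.i.toLinearMap ∘ₗ l ∘ₗ X.σ.toLinearMap + Y.i.toLinearMap ∘ₗ p
    have h₀_apply : ∀ x, h₀ x = s' (X.σ x) - Y.i (l (X.σ x)) + Y.i (p x) := fun x => rfl
    have key : ∀ x, h₀ x = b' (X.σ x) + Y.i ((f - g) (X.σ x) - l (X.σ x))
        + Y.i (p x - f (X.σ x)) := by
      intro x
      have := hg (X.σ x)
      rw [h₀_apply, Pi.sub_apply]
      simp only [map_sub]
      rw [this]
      abel
    have key2 : ∀ x, X.i (p x - f (X.σ x)) = x - b (X.σ x) := by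
      intro x
      rw [map_sub, hp', hf]
      abel
    have hC0 : ∀ {A : ℝ} {x : X.G} {t : ℝ}, t ≤ A * ‖X.σ x‖ → t ≤ |A| * ‖X.σ‖ * ‖x‖ := by
      intro A x t ht
      refine ht.trans ((mul_le_mul_of_nonneg_right (le_abs_self A) (norm_nonneg _)).trans ?_)
      rw [mul_assoc]
      exact mul_le_mul_of_nonneg_left (X.σ.le_opNorm x) (abs_nonneg A)
    let h : X.G →L[𝕜] Y.G := h₀.mkContinuous
      (|C'| * ‖X.σ‖ + ‖Y.i‖ * (|D| * ‖X.σ‖) + ‖Y.i‖ * (K * (1 + |C| * ‖X.σ‖))) (by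
        intro x
        rw [key, add_mul, add_mul, mul_assoc ‖Y.i‖, mul_assoc ‖Y.i‖]
        refine norm_add_le_of_le (norm_add_le_of_le (hC0 (hC' _)) ?_) ?_
        · exact Y.i.le_opNorm_of_le (hC0 (hD _))
        · refine Y.i.le_opNorm_of_le ((hK _).trans ?_)
          rw [key2, mul_assoc, add_mul, one_mul]
          exact mul_le_mul_of_nonneg_left (norm_sub_le_of_le le_rfl (hC0 (hC _))) K.2)
    have hh : ∀ x, h x = s' (X.σ x) - Y.i (l (X.σ x)) + Y.i (p x) := fun x => rfl
    have hi : ∀ e, h (X.i e) = Y.i e := by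
      intro e
      have : p (X.i e) = e := X.injective_i (by simp [hp', σ_i])
      rw [hh, σ_i, this]
      simp
    have hσ : ∀ x, Y.σ (h x) = X.σ x := by
      intro x
      rw [hh, map_add, map_sub, σ_i, σ_i, hs']
      simp
    have hker : h.ker = ⊥ := by
      rw [LinearMap.ker_eq_bot']
      intro x hx
      have hx' : h x = 0 := hx
      have h1 : X.σ x = 0 := by rw [← hσ, hx', map_zero]
      obtain ⟨e, rfl⟩ := (X.exact x).1 h1
      rw [hi] at hx'
      have : e = 0 := Y.injective_i (by rw [hx', map_zero])
      rw [this, map_zero]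
    have hrange : h.range = ⊤ := by
      rw [LinearMap.range_eq_top]
      intro z
      obtain ⟨x, hx⟩ := X.surjective_σ (Y.σ z)
      obtain ⟨e, he⟩ := (Y.exact (z - h x)).1 (by rw [map_sub, hσ, hx, sub_self])
      refine ⟨x + X.i e, ?_⟩
      change h (x + X.i e) = z
      rw [map_add, hi, he]
      abel
    exact ⟨ContinuousLinearEquiv.ofBijective h hker hrange, hi, hσ⟩

lemma isTwist_split [CompleteSpace E] [CompleteSpace F] : IsTwist (split 𝕜 F E) 0 := by
  refine ⟨LinearMap.inr 𝕜 E F, fun y => ((0 : E), y), 1, fun y => rfl, fun y => rfl, fun y => ?_,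
    fun y => ?_⟩
  · change ‖((0 : E), y)‖ ≤ _
    simp [Prod.norm_def]
  · change (split 𝕜 F E).i 0 = ((0 : E), y) - ((0 : E), y)
    rw [map_zero, sub_self]
    rfl

lemma IsTwist.directSum {X : BanachExtension 𝕜 F E} {Y : BanachExtension 𝕜 F' E'} {f : F → E}
    {g : F' → E'} (hX : IsTwist X f) (hY : IsTwist Y g) :
    IsTwist (directSum X Y) (Prod.map f g) := by
  obtain ⟨s, b, C, hs, hb, hC, hf⟩ := hX
  obtain ⟨s', b', C', hs', hb', hC', hg⟩ := hY
  refine ⟨s.prodMap s', Prod.map b b', max |C| |C'|, fun y => Prod.ext (hs _) (hs' _),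
    fun y => Prod.ext (hb _) (hb' _), fun y => ?_, fun y => Prod.ext (hf _) (hg _)⟩
  refine (Prod.norm_def (Prod.map b b' y)).le.trans (max_le ?_ ?_)
  · refine (hC y.1).trans (mul_le_mul ?_ (norm_fst_le y) (norm_nonneg _) (by positivity))
    exact (le_abs_self C).trans (le_max_left _ _)
  · refine (hC' y.2).trans (mul_le_mul ?_ (norm_snd_le y) (norm_nonneg _) (by positivity))
    exact (le_abs_self C').trans (le_max_right _ _)

lemma IsTwist.pushout [CompleteSpace E] [CompleteSpace E'] {X : BanachExtension 𝕜 F E} {f : F → E}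
    (T : E →L[𝕜] E') (hX : IsTwist X f) : IsTwist (pushout T X) (T ∘ f) := by
  obtain ⟨s, b, C, hs, hb, hC, hf⟩ := hX
  refine ⟨(pushoutSubmodule T X).mkQ ∘ₗ LinearMap.inl 𝕜 X.G E' ∘ₗ s,
    fun y => (pushoutSubmodule T X).mkQ (b y, 0), C, hs, hb, fun y => ?_, fun y => ?_⟩
  · refine (Submodule.Quotient.norm_mk_le (pushoutSubmodule T X) (b y, (0 : E'))).trans ?_
    rw [Prod.norm_def]
    simpa using hC y
  · change Submodule.Quotient.mk ((0 : X.G), T (f y)) =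
      (Submodule.Quotient.mk ((b y, (0 : E')) - (s y, (0 : E'))) :
        (X.G × E') ⧸ pushoutSubmodule T X)
    rw [Submodule.Quotient.eq]
    exact (mem_pushoutSubmodule T X _).2 ⟨-f y, by simp [hf], by simp⟩

lemma IsTwist.pullback [CompleteSpace F'] {X : BanachExtension 𝕜 F E} {f : F → E}
    (S : F' →L[𝕜] F) (hX : IsTwist X f) : IsTwist (pullback S X) (f ∘ S) := by
  obtain ⟨s, b, C, hs, hb, hC, hf⟩ := hX
  refine ⟨((s ∘ₗ S.toLinearMap).prod LinearMap.id).codRestrict (pullbackSubmodule S X)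
      (fun y => hs (S y)),
    fun y => ⟨(b (S y), y), hb (S y)⟩, max (|C| * ‖S‖) 1, fun y => rfl, fun y => rfl,
    fun y => ?_, fun y => Subtype.ext (Prod.ext (hf (S y)) (sub_self y).symm)⟩
  change ‖(b (S y), y)‖ ≤ _
  rw [Prod.norm_def]
  refine max_le ?_ ?_
  · refine (hC (S y)).trans ?_
    calc C * ‖S y‖ ≤ |C| * (‖S‖ * ‖y‖) :=
          mul_le_mul (le_abs_self C) (S.le_opNorm y) (norm_nonneg _) (abs_nonneg C)
      _ ≤ max (|C| * ‖S‖) 1 * ‖y‖ := by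
          rw [← mul_assoc]
          exact mul_le_mul_of_nonneg_right (le_max_left _ _) (norm_nonneg y)
  · calc ‖y‖ = 1 * ‖y‖ := (one_mul _).symm
      _ ≤ max (|C| * ‖S‖) 1 * ‖y‖ :=
          mul_le_mul_of_nonneg_right (le_max_right _ _) (norm_nonneg y)

lemma IsTwist.baerSum [CompleteSpace E] [CompleteSpace F] {X Y : BanachExtension 𝕜 F E}
    {f g : F → E} (hX : IsTwist X f) (hY : IsTwist Y g) : IsTwist (baerSum X Y) (f + g) :=
  ((hX.directSum hY).pushout _).pullback _

lemma IsTwist.smul [CompleteSpace E] {X : BanachExtension 𝕜 F E} {f : F → E} (c : 𝕜)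
    (hX : IsTwist X f) : IsTwist (X.pushout (c • ContinuousLinearMap.id 𝕜 E)) (c • f) :=
  hX.pushout _

end BanachExtension

/-- `Ext¹(F, E)`: the set of congruence classes of extensions `0 → E → G → F → 0`. -/
def Ext1 (𝕜 : Type*) [RCLike 𝕜]
    (F : Type v) [NormedAddCommGroup F] [NormedSpace 𝕜 F]
    (E : Type u) [NormedAddCommGroup E] [NormedSpace 𝕜 E] :=
  Quotient (BanachExtension.setoid 𝕜 F E)

namespace Ext1

open BanachExtension

variable {𝕜 : Type*} [RCLike 𝕜]
  {F : Type v} [NormedAddCommGroup F] [NormedSpace 𝕜 F] [CompleteSpace F]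
  {E : Type u} [NormedAddCommGroup E] [NormedSpace 𝕜 E] [CompleteSpace E]

/-- The congruence class of an extension. -/
def mk (X : BanachExtension 𝕜 F E) : Ext1 𝕜 F E := Quotient.mk _ X

/-- The zero element is the class of the split extension. -/
instance : Zero (Ext1 𝕜 F E) := ⟨mk (split 𝕜 F E)⟩

/-- Addition is the Baer sum. -/
noncomputable instance : Add (Ext1 𝕜 F E) where
  add := Quotient.map₂ baerSum (by
    intro X X' hX Y Y' hY
    obtain ⟨f, hf⟩ := X.exists_isTwist
    obtain ⟨f', hf'⟩ := X'.exists_isTwist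
    obtain ⟨g, hg⟩ := Y.exists_isTwist
    obtain ⟨g', hg'⟩ := Y'.exists_isTwist
    refine (congruent_iff (hf.baerSum hg) (hf'.baerSum hg')).2 ?_
    rw [add_sub_add_comm]
    exact add_mem ((congruent_iff hf hf').1 hX) ((congruent_iff hg hg').1 hY))

/-- The scalar multiple `c α` is `(c I_E) α`. -/
noncomputable instance : SMul 𝕜 (Ext1 𝕜 F E) where
  smul c := Quotient.map (pushout (c • ContinuousLinearMap.id 𝕜 E)) (by
    intro X X' hX
    obtain ⟨f, hf⟩ := X.exists_isTwist
    obtain ⟨f', hf'⟩ := X'.exists_isTwist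
    refine (congruent_iff (hf.smul c) (hf'.smul c)).2 ?_
    rw [← smul_sub]
    exact Submodule.smul_mem _ c ((congruent_iff hf hf').1 hX))

lemma mk_add_mk (X Y : BanachExtension 𝕜 F E) : mk X + mk Y = mk (baerSum X Y) := rfl

lemma smul_mk (c : 𝕜) (X : BanachExtension 𝕜 F E) :
    c • mk X = mk (X.pushout (c • ContinuousLinearMap.id 𝕜 E)) := rfl

set_option linter.unusedSectionVars false in
lemma exists_rep (α : Ext1 𝕜 F E) : ∃ X f, IsTwist X f ∧ mk X = α := by
  obtain ⟨X, rfl⟩ := Quotient.exists_rep α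
  obtain ⟨f, hf⟩ := X.exists_isTwist
  exact ⟨X, f, hf, rfl⟩

set_option linter.unusedSectionVars false in
lemma mk_eq {X Y : BanachExtension 𝕜 F E} {f : F → E} (hX : IsTwist X f) (hY : IsTwist Y f) :
    mk X = mk Y :=
  Quotient.sound ((congruent_iff hX hY).2 (by rw [sub_self]; exact zero_mem _))

noncomputable instance : Neg (Ext1 𝕜 F E) := ⟨fun α => (-1 : 𝕜) • α⟩

noncomputable instance : AddCommGroup (Ext1 𝕜 F E) where
  nsmul := nsmulRec
  zsmul := zsmulRec
  add_assoc α β γ := by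
    obtain ⟨X, f, hf, rfl⟩ := exists_rep α
    obtain ⟨Y, g, hg, rfl⟩ := exists_rep β
    obtain ⟨Z, h, hh, rfl⟩ := exists_rep γ
    exact mk_eq ((hf.baerSum hg).baerSum hh) (add_assoc f g h ▸ hf.baerSum (hg.baerSum hh))
  add_comm α β := by
    obtain ⟨X, f, hf, rfl⟩ := exists_rep α
    obtain ⟨Y, g, hg, rfl⟩ := exists_rep β
    exact mk_eq (hf.baerSum hg) (add_comm f g ▸ hg.baerSum hf)
  zero_add α := by
    obtain ⟨X, f, hf, rfl⟩ := exists_rep α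
    exact mk_eq (isTwist_split.baerSum hf) ((zero_add f).symm ▸ hf)
  add_zero α := by
    obtain ⟨X, f, hf, rfl⟩ := exists_rep α
    exact mk_eq (hf.baerSum isTwist_split) ((add_zero f).symm ▸ hf)
  neg_add_cancel α := by
    obtain ⟨X, f, hf, rfl⟩ := exists_rep α
    refine mk_eq ((hf.smul (-1 : 𝕜)).baerSum hf) ?_
    rw [neg_one_smul, neg_add_cancel]
    exact isTwist_split

noncomputable instance : Module 𝕜 (Ext1 𝕜 F E) where
  one_smul α := by
    obtain ⟨X, f, hf, rfl⟩ := exists_rep α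
    exact mk_eq (hf.smul (1 : 𝕜)) ((one_smul 𝕜 f).symm ▸ hf)
  mul_smul c d α := by
    obtain ⟨X, f, hf, rfl⟩ := exists_rep α
    exact mk_eq (hf.smul (c * d)) (mul_smul c d f ▸ (hf.smul d).smul c)
  smul_zero c := by
    refine mk_eq (isTwist_split.smul c) ?_
    rw [smul_zero]
    exact isTwist_split
  smul_add c α β := by
    obtain ⟨X, f, hf, rfl⟩ := exists_rep α
    obtain ⟨Y, g, hg, rfl⟩ := exists_rep β
    exact mk_eq ((hf.baerSum hg).smul c) (smul_add c f g ▸ (hf.smul c).baerSum (hg.smul c))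
  add_smul c d α := by
    obtain ⟨X, f, hf, rfl⟩ := exists_rep α
    exact mk_eq (hf.smul (c + d)) (add_smul c d f ▸ (hf.smul c).baerSum (hf.smul d))
  zero_smul α := by
    obtain ⟨X, f, hf, rfl⟩ := exists_rep α
    exact mk_eq (hf.smul (0 : 𝕜)) ((zero_smul 𝕜 f).symm ▸ isTwist_split)

end Ext1

end Extensions

section BanachSpaceProperties

variable (𝕜 : Type*) [RCLike 𝕜] (E : Type u) [NormedAddCommGroup E] [NormedSpace 𝕜 E]

/-- `E` is an `𝓛_p`-space: for some `C`, every finite-dimensional subspace `A` lies in a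
finite-dimensional subspace `B` whose Banach-Mazur distance to some `ℓ_p^n` is at most `C`. -/
def IsScriptLpSpace (p : ℝ≥0∞) [Fact (1 ≤ p)] : Prop :=
  ∃ C : ℝ, ∀ A : Submodule 𝕜 E, FiniteDimensional 𝕜 A →
    ∃ B : Submodule 𝕜 E, A ≤ B ∧ ∃ (n : ℕ) (e : B ≃L[𝕜] PiLp p fun _ : Fin n => 𝕜),
      ‖(e : B →L[𝕜] PiLp p fun _ : Fin n => 𝕜)‖ *
        ‖(e.symm : (PiLp p fun _ : Fin n => 𝕜) →L[𝕜] B)‖ ≤ C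

/-- The canonical map into the bidual is onto. -/
def IsReflexiveBanach : Prop :=
  Function.Surjective (NormedSpace.inclusionInDoubleDual 𝕜 E)

/-- Approximation property. -/
def HasAP : Prop :=
  ∀ K : Set E, IsCompact K → ∃ T : ℕ → E →L[𝕜] E,
    (∀ n, FiniteDimensional 𝕜 (T n).range) ∧ TendstoUniformlyOn (fun n => ⇑(T n)) id atTop K

/-- Bounded approximation property: there is a net of finite-rank operators, bounded in norm, that
converges to the identity uniformly on compact sets. -/
def HasBAP : Prop :=
  ∃ (ι : Type u) (_ : Preorder ι) (_ : IsDirectedOrder ι) (_ : Nonempty ι) (T : ι → E →L[𝕜] E),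
    (∀ β, FiniteDimensional 𝕜 (T β).range) ∧ (∃ C : ℝ, ∀ β, ‖T β‖ ≤ C) ∧
      ∀ K : Set E, IsCompact K → TendstoUniformlyOn (fun β => ⇑(T β)) id atTop K

/-- `E` is isomorphic to the dual of a Banach space. -/
def IsIsomorphicToDual : Prop :=
  ∃ (X : Type u) (_ : NormedAddCommGroup X) (_ : NormedSpace 𝕜 X) (_ : CompleteSpace X),
    Nonempty (E ≃L[𝕜] StrongDual 𝕜 X)

/-- The alternative hypotheses under which `Ext¹(F, E)` is either zero or infinite-dimensional. -/
def ZeroOrInfiniteHypothesis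
    (F : Type v) [NormedAddCommGroup F] [NormedSpace 𝕜 F] : Prop :=
  (IsReflexiveBanach 𝕜 E ∧ HasAP 𝕜 E) ∨
  (HasBAP 𝕜 F ∧ (IsIsomorphicToDual 𝕜 F ∨ IsIsomorphicToDual 𝕜 E)) ∨
  Nonempty ((E × E) ≃L[𝕜] E) ∨ Nonempty ((F × F) ≃L[𝕜] F)

end BanachSpaceProperties

/-! An `𝓛₂`-space is Hilbertian: the inner products of its uniformly Euclidean finite-dimensional
subspaces have an ultrafilter limit, which is an equivalent inner product on the whole space
(`IsScriptLpSpace.exists_equiv_lp`). So `E ≅ ℓ₂(κ)` and `F ≅ ℓ₂(κ')` with infinite index sets, and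
it suffices to produce infinitely many linearly independent extensions.

By `congruent_iff`, the class of an extension is its twist `F → E` modulo sums of a linear and a
bounded map. The twists come from the Kalton–Peck map `Ω(c)_k = c_k log(|c_k|/‖c‖)`. For finitely
supported `z` with `‖z‖ ≤ 1`, the pairing of `z` with `Ω(c)` is within `2‖c‖` of the linear
functional `c ↦ ∑ z_k log|z_k| c_k` (`norm_sum_mul_kaltonPeck_sub_le`). Hence `Ω` is additive modulo
`ℓ₂`, so it takes values in `ℓ₂` after subtraction of a linear map. The same estimate gives the
middle space a genuine norm, as a supremum over `z`, rather than only a quasi-norm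
(`exists_isTwist_of_functionals`).

`Ω` is not linear plus bounded: it vanishes on basis vectors and multiplies a signed sum of `n` of
them by `-log √n`, whereas signs can be chosen for which the bounded part contributes only `O(√n)`
(`eq_zero_of_smul_kaltonPeck_sub_bounded`). Finally, infinitely many disjoint infinite blocks are
cut out of `κ'` and the Kalton–Peck extension is pulled back along each block projection. Testing a
combination on one block isolates one coefficient (`not_finiteDimensional_ext1`). -/

/-! ### Hilbertian renorming of `𝓛₂`-spaces. -/

section HilbertRenorming

/-- A type synonym, used to give a Banach space the norm of an equivalent inner product. -/
def HilbertRenorming (E : Type u) : Type u := E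

instance (E : Type u) [AddCommGroup E] : AddCommGroup (HilbertRenorming E) :=
  inferInstanceAs (AddCommGroup E)

instance (𝕜 : Type*) (E : Type u) [Semiring 𝕜] [AddCommGroup E] [Module 𝕜 E] :
    Module 𝕜 (HilbertRenorming E) :=
  inferInstanceAs (Module 𝕜 E)

variable {𝕜 : Type*} [RCLike 𝕜] {E : Type u} [NormedAddCommGroup E] [NormedSpace 𝕜 E]

/-- A Banach space with an equivalent inner product is isomorphic to a space `ℓ₂(κ)`. -/
lemma exists_equiv_lp_of_core [CompleteSpace E] (c : InnerProductSpace.Core 𝕜 E) (C : ℝ)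
    (hC : 0 ≤ C)
    (h₁ : ∀ x, ‖x‖ ^ 2 ≤ RCLike.re (c.inner x x))
    (h₂ : ∀ x, RCLike.re (c.inner x x) ≤ C ^ 2 * ‖x‖ ^ 2) :
    ∃ κ : Type u, Nonempty (E ≃L[𝕜] lp (fun _ : κ => 𝕜) 2) := by
  let c' : InnerProductSpace.Core 𝕜 (HilbertRenorming E) := c
  let _ : NormedAddCommGroup (HilbertRenorming E) := c'.toNormedAddCommGroup
  let _ : InnerProductSpace 𝕜 (HilbertRenorming E) := InnerProductSpace.ofCore c'.toCore
  let e₀ : E ≃ₗ[𝕜] HilbertRenorming E := LinearEquiv.refl 𝕜 E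
  have hn : ∀ x : E, ‖e₀ x‖ = √(RCLike.re (c.inner x x)) := fun x => rfl
  let e : E ≃L[𝕜] HilbertRenorming E := e₀.toContinuousLinearEquivOfBounds C 1
    (fun x => by
      rw [hn]
      exact Real.sqrt_le_iff.2 ⟨by positivity, by rw [mul_pow]; exact h₂ x⟩)
    (fun x => by
      rw [one_mul]
      obtain ⟨y, rfl⟩ := e₀.surjective x
      rw [e₀.symm_apply_apply, hn]
      exact Real.le_sqrt_of_sq_le (h₁ y))
  have : CompleteSpace (HilbertRenorming E) :=
    (completeSpace_congr (e := e.toEquiv) e.isUniformEmbedding).1 inferInstance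
  obtain ⟨w, b, -⟩ := exists_hilbertBasis 𝕜 (HilbertRenorming E)
  exact ⟨w, ⟨e.trans b.repr.toContinuousLinearEquiv⟩⟩

/-- An `𝓛₂`-space is isomorphic to a space `ℓ₂(κ)`. -/
theorem IsScriptLpSpace.exists_equiv_lp [CompleteSpace E] (h : IsScriptLpSpace 𝕜 E 2) :
    ∃ κ : Type u, Nonempty (E ≃L[𝕜] lp (fun _ : κ => 𝕜) 2) := by
  obtain ⟨C₀, hC₀⟩ := h
  set C : ℝ := |C₀|
  have hC : 0 ≤ C := abs_nonneg _
  have key : ∀ s : Finset E, ∃ (n : ℕ) (B : Submodule 𝕜 E)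
      (T : B →ₗ[𝕜] EuclideanSpace 𝕜 (Fin n)), (∀ x ∈ s, x ∈ B) ∧
      (∀ x, ‖x‖ ≤ ‖T x‖) ∧ ∀ x, ‖T x‖ ≤ C * ‖x‖ := by
    intro s
    obtain ⟨B, hB, n, e, he⟩ := hC₀ (Submodule.span 𝕜 (s : Set E)) inferInstance
    set a := ‖(e.symm : (PiLp 2 fun _ : Fin n => 𝕜) →L[𝕜] B)‖
    have hna : ‖(a : 𝕜)‖ = a := by simp [a]
    -- Scaling `e` by `‖e⁻¹‖` puts the whole distortion into the upper bound, so all local norms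
    -- dominate `‖x‖`.
    refine ⟨n, B, (a : 𝕜) • e.toLinearEquiv.toLinearMap,
      fun x hx => hB (Submodule.subset_span hx), fun x => ?_, fun x => ?_⟩
    · change ‖x‖ ≤ ‖(a : 𝕜) • e x‖
      rw [norm_smul, hna]
      simpa using (e.symm : (PiLp 2 fun _ : Fin n => 𝕜) →L[𝕜] B).le_opNorm (e x)
    · change ‖(a : 𝕜) • e x‖ ≤ _
      rw [norm_smul, hna]
      refine (mul_le_mul_of_nonneg_left
        ((e : B →L[𝕜] PiLp 2 fun _ : Fin n => 𝕜).le_opNorm x) (norm_nonneg _)).trans ?_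
      rw [← mul_assoc, mul_comm a]
      exact mul_le_mul_of_nonneg_right (he.trans (le_abs_self _)) (norm_nonneg _)
  choose n B T hB hT₁ hT₂ using key
  classical
  -- The value `0` outside `B s` destroys linearity, but for fixed vectors only on a set of `s` that
  -- the ultrafilter ignores.
  let φ : ∀ s, E → EuclideanSpace 𝕜 (Fin (n s)) := fun s x =>
    if hx : x ∈ B s then T s ⟨x, hx⟩ else 0
  have hφ : ∀ s x (hx : x ∈ B s), φ s x = T s ⟨x, hx⟩ := fun s x hx => dif_pos hx
  have hφ_le : ∀ s x, ‖φ s x‖ ≤ C * ‖x‖ := by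
    intro s x
    by_cases hx : x ∈ B s
    · rw [hφ s x hx]
      exact hT₂ s ⟨x, hx⟩
    · simp only [φ, hx, dif_neg, not_false_iff, norm_zero]
      positivity
  have : Nonempty (Finset E) := ⟨∅⟩
  let U : Ultrafilter (Finset E) := Ultrafilter.of atTop
  have hU : ∀ x : E, ∀ᶠ s in (U : Filter (Finset E)), x ∈ B s := by
    intro x
    refine Filter.Eventually.filter_mono (Ultrafilter.of_le atTop) ?_
    filter_upwards [eventually_ge_atTop {x}] with s hs
    exact hB s x (hs (Finset.mem_singleton_self x))
  have hlim : ∀ x y, ∃ z : 𝕜, Tendsto (fun s => inner 𝕜 (φ s x) (φ s y)) U (𝓝 z) := by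
    intro x y
    have hK : IsCompact (Metric.closedBall (0 : 𝕜) ((C * ‖x‖) * (C * ‖y‖))) :=
      isCompact_closedBall _ _
    obtain ⟨z, -, hz⟩ := hK.ultrafilter_le_nhds
      (U.map fun s => inner 𝕜 (φ s x) (φ s y)) (by
        refine Filter.le_principal_iff.2 (Filter.mem_map.2 (Filter.univ_mem' fun s => ?_))
        refine mem_closedBall_zero_iff.2 ((norm_inner_le_norm _ _).trans ?_)
        exact mul_le_mul (hφ_le s x) (hφ_le s y) (norm_nonneg _) (by positivity))
    exact ⟨z, hz⟩
  choose I hI using hlim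
  have hsq : ∀ x, Tendsto (fun s => ‖φ s x‖ ^ 2) U (𝓝 (RCLike.re (I x x))) := by
    intro x
    refine ((RCLike.continuous_re.tendsto _).comp (hI x x)).congr fun s => ?_
    exact (norm_sq_eq_re_inner (𝕜 := 𝕜) (φ s x)).symm
  have h₁ : ∀ x, ‖x‖ ^ 2 ≤ RCLike.re (I x x) := by
    intro x
    refine ge_of_tendsto (hsq x) ?_
    filter_upwards [hU x] with s hs
    rw [hφ s x hs]
    exact pow_le_pow_left₀ (norm_nonneg _) (hT₁ s ⟨x, hs⟩) 2
  have h₂ : ∀ x, RCLike.re (I x x) ≤ C ^ 2 * ‖x‖ ^ 2 := by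
    intro x
    refine le_of_tendsto (hsq x) (Eventually.of_forall fun s => ?_)
    rw [← mul_pow]
    exact pow_le_pow_left₀ (norm_nonneg _) (hφ_le s x) 2
  -- Each identity holds at every `s` whose `B s` contains the vectors involved, hence in the limit;
  -- definiteness comes from the lower bound `h₁`.
  let c : InnerProductSpace.Core 𝕜 E :=
    { inner := I
      conj_inner_symm := fun x y => by
        refine tendsto_nhds_unique
          (((RCLike.continuous_conj (K := 𝕜)).tendsto _).comp (hI y x)) ((hI x y).congr fun s => ?_)
        exact (inner_conj_symm (φ s x) (φ s y)).symm
      re_inner_nonneg := fun x => (sq_nonneg ‖x‖).trans (h₁ x)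
      add_left := fun x y z => by
        refine tendsto_nhds_unique (hI (x + y) z) (((hI x z).add (hI y z)).congr' ?_)
        filter_upwards [hU x, hU y] with s hx hy
        rw [hφ s x hx, hφ s y hy, hφ s (x + y) ((B s).add_mem hx hy), ← inner_add_left, ← map_add]
        rfl
      smul_left := fun x y r => by
        refine tendsto_nhds_unique (hI (r • x) y) (((hI x y).const_mul _).congr' ?_)
        filter_upwards [hU x] with s hx
        rw [hφ s x hx, hφ s (r • x) ((B s).smul_mem r hx), ← inner_smul_left, ← map_smul]
        rfl
      definite := fun x hx => by
        have h := h₁ x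
        rw [hx, map_zero] at h
        exact norm_eq_zero.1 (pow_eq_zero_iff two_ne_zero |>.1 (le_antisymm h (sq_nonneg _))) }
  exact exists_equiv_lp_of_core c C hC h₁ h₂

end HilbertRenorming

/-! ### Middle spaces normed by functionals. -/

section TwistedSum

/-- A type synonym for `E × F`, used for the middle space of a twisted sum. -/
def TwistedSum (F : Type v) (E : Type u) : Type (max u v) := E × F

instance (F : Type v) (E : Type u) [AddCommGroup E] [AddCommGroup F] : AddCommGroup (TwistedSum F E) :=
  inferInstanceAs (AddCommGroup (E × F))

instance (𝕜 : Type*) (F : Type v) (E : Type u) [Semiring 𝕜] [AddCommGroup E] [AddCommGroup F]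
    [Module 𝕜 E] [Module 𝕜 F] :
    Module 𝕜 (TwistedSum F E) :=
  inferInstanceAs (Module 𝕜 (E × F))

variable {𝕜 : Type*} [RCLike 𝕜]
  {E : Type u} [NormedAddCommGroup E] [NormedSpace 𝕜 E]
  {F : Type v} [NormedAddCommGroup F] [NormedSpace 𝕜 F]

/-- Completeness is a three-space property. -/
lemma completeSpace_of_exact [CompleteSpace E] [CompleteSpace F]
    {G : Type*} [NormedAddCommGroup G] [NormedSpace 𝕜 G] (i : E →L[𝕜] G) (σ : G →L[𝕜] F)
    (b : F → G) {K C : ℝ} (hK : ∀ e, ‖e‖ ≤ K * ‖i e‖) (hσ : ∀ y, σ (b y) = y)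
    (hC : ∀ y, ‖b y‖ ≤ C * ‖y‖) (hex : ∀ g, σ g = 0 → ∃ e, i e = g) : CompleteSpace G := by
  refine Metric.complete_of_cauchySeq_tendsto fun g hg => ?_
  obtain ⟨y, hy⟩ := cauchySeq_tendsto_of_complete (σ.uniformContinuous.comp_cauchySeq hg)
  -- The section `b` need not be continuous, but its bound makes it small near `0`. This correction
  -- moves `g n - b y` into the kernel of `σ`, where completeness of `E` applies.
  have hr : Tendsto (fun n => b (y - σ (g n))) atTop (𝓝 0) := by
    refine squeeze_zero_norm (fun n => hC _) ?_
    simpa using (tendsto_iff_norm_sub_tendsto_zero.1 hy).congr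
      (fun n => norm_sub_rev _ _) |>.const_mul C
  have hlift : ∀ n, ∃ e, i e = g n + b (y - σ (g n)) - b y :=
    fun n => hex _ (by simp [hσ])
  choose e he using hlift
  have hie : CauchySeq fun n => i (e n) := by
    simp only [he]
    simp only [sub_eq_add_neg _ (b y)]
    exact (hg.add hr.cauchySeq).add (cauchySeq_const (-b y))
  have hec : CauchySeq e := by
    have hanti : AntilipschitzWith (Real.toNNReal K) i :=
      ContinuousLinearMap.antilipschitz_of_bound _ fun x => (hK x).trans
        (mul_le_mul_of_nonneg_right (Real.le_coe_toNNReal K) (norm_nonneg _))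
    exact (hanti.isUniformInducing i.uniformContinuous).cauchy_map_iff.1 (by
      rwa [Filter.map_map])
  obtain ⟨e₀, he₀⟩ := cauchySeq_tendsto_of_complete hec
  refine ⟨i e₀ + b y, ?_⟩
  have := (((i.continuous.tendsto e₀).comp he₀).add_const (b y)).sub hr
  refine (this.congr fun n => ?_).trans (by simp)
  simp [he]

namespace BanachExtension

/-- A map `f : F → E` is the twist of an extension as soon as its compositions with the members of
a norming family of functionals are uniformly close to linear functionals.  The norm of the middle
space is `‖(x, y)‖ = max ‖y‖ (sup |z x - ψ_z y|)`. -/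
theorem exists_isTwist_of_functionals [CompleteSpace E] [CompleteSpace F] {ι : Type*} (f : F → E)
    (z : ι → StrongDual 𝕜 E) (ψ : ι → F →ₗ[𝕜] 𝕜) {K M C : ℝ} (hM : ∀ i x, ‖z i x‖ ≤ M * ‖x‖)
    (hK : ∀ x r, 0 ≤ r → (∀ i, ‖z i x‖ ≤ r) → ‖x‖ ≤ K * r)
    (hψ : ∀ i y, ‖z i (f y) - ψ i y‖ ≤ C * ‖y‖) :
    ∃ X : BanachExtension 𝕜 F E, IsTwist X f := by
  have hbd : ∀ (x : E) (y : F) i, ‖z i x - ψ i y‖ ≤ M * ‖x - f y‖ + C * ‖y‖ := by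
    intro x y i
    have : z i x - ψ i y = z i (x - f y) + (z i (f y) - ψ i y) := by
      rw [map_sub]
      ring
    rw [this]
    exact norm_add_le_of_le (hM i _) (hψ i y)
  -- Linearity of each `ψ i` makes `Λ` linear, so it induces a norm; `hbd` puts the second component
  -- in `ℓ_∞`.
  let Λ : TwistedSum F E →ₗ[𝕜] F × lp (fun _ : ι => 𝕜) ∞ :=
    { toFun := fun p => (p.2, ⟨fun i => z i p.1 - ψ i p.2, memℓp_infty
        ⟨_, by rintro _ ⟨i, rfl⟩; exact hbd p.1 p.2 i⟩⟩)
      map_add' := fun p q => by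
        refine Prod.ext rfl (lp.ext (funext fun i => ?_))
        change z i (p.1 + q.1) - ψ i (p.2 + q.2) = (z i p.1 - ψ i p.2) + (z i q.1 - ψ i q.2)
        rw [map_add, map_add]
        ring
      map_smul' := fun c p => by
        refine Prod.ext rfl (lp.ext (funext fun i => ?_))
        change z i (c • p.1) - ψ i (c • p.2) = c • (z i p.1 - ψ i p.2)
        rw [map_smul, map_smul, smul_sub] }
  have hΛ₁ : ∀ p, (Λ p).1 = p.2 := fun p => rfl
  have hΛ₂ : ∀ p i, (Λ p).2 i = z i p.1 - ψ i p.2 := fun p i => rfl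
  have hinj : Function.Injective Λ := by
    refine (injective_iff_map_eq_zero Λ).2 fun p hp => ?_
    have h2 : p.2 = 0 := by rw [← hΛ₁, hp]; rfl
    have h1 : ∀ i, z i p.1 = 0 := by
      intro i
      have := hΛ₂ p i
      rw [hp, h2, map_zero, sub_zero] at this
      exact this.symm
    have h3 := hK p.1 0 le_rfl fun i => by simp [h1]
    rw [mul_zero] at h3
    exact Prod.ext (norm_le_zero_iff.1 h3) h2
  let _ : NormedAddCommGroup (TwistedSum F E) := NormedAddCommGroup.induced _ _ Λ hinj
  let _ : NormedSpace 𝕜 (TwistedSum F E) := NormedSpace.induced 𝕜 _ _ Λ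
  have hnorm : ∀ p : TwistedSum F E, ‖p‖ = ‖Λ p‖ := fun p => rfl
  have hle : ∀ (p : TwistedSum F E) (r : ℝ), 0 ≤ r → ‖p.2‖ ≤ r →
      (∀ i, ‖z i p.1 - ψ i p.2‖ ≤ r) → ‖p‖ ≤ r := fun p r hr h1 h2 => by
    rw [hnorm]
    exact max_le h1 (lp.norm_le_of_forall_le hr h2)
  have hge : ∀ (p : TwistedSum F E) i, ‖z i p.1 - ψ i p.2‖ ≤ ‖p‖ := fun p i => by
    rw [hnorm, ← hΛ₂]
    exact (lp.norm_apply_le_norm ENNReal.top_ne_zero _ i).trans (norm_snd_le _)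
  have hge' : ∀ p : TwistedSum F E, ‖p.2‖ ≤ ‖p‖ := fun p => by
    rw [hnorm, ← hΛ₁]
    exact norm_fst_le _
  let i₀ : E →ₗ[𝕜] TwistedSum F E := LinearMap.inl 𝕜 E F
  let σ₀ : TwistedSum F E →ₗ[𝕜] F := LinearMap.snd 𝕜 E F
  let i : E →L[𝕜] TwistedSum F E := i₀.mkContinuous |M| fun x => by
    refine hle _ _ (by positivity) ?_ fun j => ?_
    · change ‖(0 : F)‖ ≤ _
      rw [norm_zero]
      positivity
    · change ‖z j x - ψ j 0‖ ≤ _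
      rw [map_zero, sub_zero]
      exact (hM j x).trans (mul_le_mul_of_nonneg_right (le_abs_self M) (norm_nonneg _))
  let σ : TwistedSum F E →L[𝕜] F := σ₀.mkContinuous 1 fun p => by
    rw [one_mul]
    exact hge' p
  let b : F → TwistedSum F E := fun y => (f y, y)
  have hb : ∀ y, ‖b y‖ ≤ max 1 C * ‖y‖ := by
    intro y
    refine hle _ _ (mul_nonneg (zero_le_one.trans (le_max_left _ _)) (norm_nonneg _)) ?_
      fun j => ?_
    · exact le_mul_of_one_le_left (norm_nonneg y) (le_max_left _ _)
    · exact (hψ j y).trans (mul_le_mul_of_nonneg_right (le_max_right _ _) (norm_nonneg y))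
  have hi : ∀ x, ‖x‖ ≤ K * ‖i x‖ := by
    intro x
    refine hK x _ (norm_nonneg _) fun j => ?_
    have : ‖z j x - ψ j 0‖ ≤ ‖i x‖ := hge (i x) j
    rwa [map_zero, sub_zero] at this
  have hex : ∀ g, σ g = 0 → ∃ x, i x = g := fun g hg => ⟨g.1, Prod.ext rfl hg.symm⟩
  let X : BanachExtension 𝕜 F E :=
    { G := TwistedSum F E
      completeSpace := completeSpace_of_exact i σ b hi (fun _ => rfl) hb hex
      i := i
      σ := σ
      injective_i := fun x x' h => congrArg Prod.fst h
      surjective_σ := fun y => ⟨b y, rfl⟩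
      exact := fun g => ⟨hex g, by rintro ⟨x, rfl⟩; rfl⟩ }
  -- The linear section `y ↦ (0, y)` and the bounded section `y ↦ (f y, y)` differ exactly by `f`.
  refine ⟨X, LinearMap.inr 𝕜 E F, b, max 1 C, fun _ => rfl, fun _ => rfl, hb, fun y => ?_⟩
  refine Prod.ext ?_ ?_
  · exact (sub_zero (f y)).symm
  · exact (sub_self y).symm

end BanachExtension

end TwistedSum

/-! ### The Kalton–Peck map and its extensions. -/

section KaltonPeck

variable {𝕜 : Type*} [RCLike 𝕜] {κ : Type*}

lemma lp.sum_norm_sq_le (x : lp (fun _ : κ => 𝕜) 2) (s : Finset κ) :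
    ∑ k ∈ s, ‖x k‖ ^ 2 ≤ ‖x‖ ^ 2 := by
  simpa using lp.sum_rpow_le_norm_rpow (p := 2) (by simp) x s

lemma lp.norm_le_of_sum_norm_sq_le {x : lp (fun _ : κ => 𝕜) 2} {C : ℝ} (hC : 0 ≤ C)
    (h : ∀ s : Finset κ, ∑ k ∈ s, ‖x k‖ ^ 2 ≤ C ^ 2) : ‖x‖ ≤ C :=
  lp.norm_le_of_forall_sum_le (p := 2) (by simp) hC (by simpa using h)

lemma norm_sum_mul_le_norm_lp {s : Finset κ} {z : κ → 𝕜} (hz : ∑ k ∈ s, ‖z k‖ ^ 2 ≤ 1)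
    (x : lp (fun _ : κ => 𝕜) 2) : ‖∑ k ∈ s, z k * x k‖ ≤ ‖x‖ := by
  refine (norm_sum_le _ _).trans ?_
  simp only [norm_mul]
  refine (Real.sum_mul_le_sqrt_mul_sqrt s _ _).trans ?_
  refine (mul_le_mul (Real.sqrt_le_one.2 hz) (Real.sqrt_le_iff.2
    ⟨norm_nonneg x, lp.sum_norm_sq_le x s⟩) (Real.sqrt_nonneg _) zero_le_one).trans ?_
  rw [one_mul]

/-- Finitely supported vectors of norm at most one norm `ℓ₂`. -/
lemma sum_norm_sq_le_of_forall {d : κ → 𝕜} {C : ℝ} {s : Finset κ}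
    (h : ∀ z : κ → 𝕜, ∑ k ∈ s, ‖z k‖ ^ 2 ≤ 1 → ‖∑ k ∈ s, z k * d k‖ ≤ C) :
    ∑ k ∈ s, ‖d k‖ ^ 2 ≤ C ^ 2 := by
  set S := ∑ k ∈ s, ‖d k‖ ^ 2
  have hS : 0 ≤ S := Finset.sum_nonneg fun k _ => sq_nonneg _
  rcases hS.eq_or_lt with h0 | hpos
  · rw [← h0]
    exact sq_nonneg C
  have hsq : √S * √S = S := Real.mul_self_sqrt hS
  have hpos' : 0 < √S := Real.sqrt_pos.2 hpos
  -- The case of equality in Cauchy–Schwarz: the normalized conjugate of `d`.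
  have h1 := h (fun k => ((√S)⁻¹ : ℝ) * (starRingEnd 𝕜) (d k)) (by
    simp only [norm_mul, mul_pow, RCLike.norm_conj, RCLike.norm_ofReal, sq_abs, inv_pow,
      Real.sq_sqrt hS]
    rw [← Finset.mul_sum, inv_mul_cancel₀ hpos.ne'])
  have h2 : ∑ k ∈ s, ((√S)⁻¹ : ℝ) * (starRingEnd 𝕜) (d k) * d k = ((√S : ℝ) : 𝕜) := by
    simp only [mul_assoc, RCLike.conj_mul]
    rw [← Finset.mul_sum]
    norm_cast
    change (√S)⁻¹ * S = √S
    rw [inv_mul_eq_iff_eq_mul₀ hpos'.ne', hsq]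
  rw [h2, RCLike.norm_ofReal, abs_of_pos hpos'] at h1
  rw [← Real.sq_sqrt hS]
  exact pow_le_pow_left₀ hpos'.le h1 2

/-- Since `log u ≤ u`, the choice `u = s/t` gives `t s log(s/t) ≤ s²`, and symmetrically. This is
the scalar inequality behind the quasi-linearity of the Kalton–Peck map. -/
lemma mul_abs_log_sub_log_le {s t : ℝ} (hs : 0 ≤ s) (ht : 0 ≤ t) :
    t * s * |Real.log s - Real.log t| ≤ s ^ 2 + t ^ 2 := by
  rcases hs.eq_or_lt with rfl | hs
  · simp [sq_nonneg]
  rcases ht.eq_or_lt with rfl | ht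
  · simp [sq_nonneg]
  have aux : ∀ {a b : ℝ}, 0 < a → 0 < b → a * b * (Real.log a - Real.log b) ≤ a ^ 2 := by
    intro a b ha hb
    rw [← Real.log_div ha.ne' hb.ne']
    have := Real.log_le_sub_one_of_pos (div_pos ha hb)
    calc a * b * Real.log (a / b) ≤ a * b * (a / b) :=
          mul_le_mul_of_nonneg_left (by linarith) (by positivity)
      _ = a ^ 2 := by field_simp
  have h1 := aux hs ht
  have h2 := aux ht hs
  rcases abs_cases (Real.log s - Real.log t) with ⟨h, -⟩ | ⟨h, -⟩ <;> rw [h] <;>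
    nlinarith [sq_nonneg s, sq_nonneg t]

/-- The Kalton–Peck map `c ↦ (c_k log (|c_k| / ‖c‖))_k` on `ℓ₂(κ)`. -/
noncomputable def kaltonPeck (c : lp (fun _ : κ => 𝕜) 2) : κ → 𝕜 :=
  fun k => (Real.log (‖c k‖ / ‖c‖) : 𝕜) * c k

lemma kaltonPeck_zero : kaltonPeck (0 : lp (fun _ : κ => 𝕜) 2) = 0 := by
  ext k
  simp [kaltonPeck]

/-- The Kalton–Peck map is, up to a sign, its own adjoint modulo bounded maps. -/
lemma norm_sum_mul_kaltonPeck_sub_le {s : Finset κ} {z : κ → 𝕜} (hz : ∑ k ∈ s, ‖z k‖ ^ 2 ≤ 1)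
    (c : lp (fun _ : κ => 𝕜) 2) :
    ‖∑ k ∈ s, z k * kaltonPeck c k - ∑ k ∈ s, z k * Real.log ‖z k‖ * c k‖ ≤ 2 * ‖c‖ := by
  rcases eq_or_ne c 0 with rfl | hc
  · simp [kaltonPeck_zero]
  have hc' : 0 < ‖c‖ := norm_pos_iff.2 hc
  rw [← Finset.sum_sub_distrib]
  refine (norm_sum_le _ _).trans ?_
  -- The scalar inequality at `|c k|/‖c‖` and `|z k|`, multiplied by `‖c‖`. Each of the two summands
  -- then adds up to at most `‖c‖`.
  have hterm : ∀ k ∈ s, ‖z k * kaltonPeck c k - z k * Real.log ‖z k‖ * c k‖ ≤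
      ‖c‖⁻¹ * ‖c k‖ ^ 2 + ‖c‖ * ‖z k‖ ^ 2 := by
    intro k _
    have h := mul_le_mul_of_nonneg_left (mul_abs_log_sub_log_le
      (div_nonneg (norm_nonneg (c k)) hc'.le) (norm_nonneg (z k))) hc'.le
    have e : z k * kaltonPeck c k - z k * Real.log ‖z k‖ * c k =
        z k * c k * ((Real.log (‖c k‖ / ‖c‖) - Real.log ‖z k‖ : ℝ) : 𝕜) := by
      rw [kaltonPeck]
      push_cast
      ring
    rw [e, norm_mul, norm_mul, RCLike.norm_ofReal]
    have h₁ : ‖c‖ * (‖z k‖ * (‖c k‖ / ‖c‖) * |Real.log (‖c k‖ / ‖c‖) - Real.log ‖z k‖|) =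
        ‖z k‖ * ‖c k‖ * |Real.log (‖c k‖ / ‖c‖) - Real.log ‖z k‖| := by
      field_simp
    have h₂ : ‖c‖ * ((‖c k‖ / ‖c‖) ^ 2 + ‖z k‖ ^ 2) =
        ‖c‖⁻¹ * ‖c k‖ ^ 2 + ‖c‖ * ‖z k‖ ^ 2 := by
      field_simp
    rwa [h₁, h₂] at h
  refine (Finset.sum_le_sum hterm).trans ?_
  rw [Finset.sum_add_distrib, ← Finset.mul_sum, ← Finset.mul_sum, two_mul]
  refine add_le_add ?_ (mul_le_of_le_one_right hc'.le hz)
  rw [inv_mul_le_iff₀ hc', ← sq]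
  exact lp.sum_norm_sq_le c s

/-- A map which is linear modulo a subspace `S` differs from a linear map by a map into `S`. -/
lemma exists_linearMap_sub_mem {V W : Type*} [AddCommGroup V] [Module 𝕜 V] [AddCommGroup W]
    [Module 𝕜 W] (S : Submodule 𝕜 W) (Ω : V → W) (hadd : ∀ x y, Ω (x + y) - (Ω x + Ω y) ∈ S)
    (hsmul : ∀ (a : 𝕜) x, Ω (a • x) - a • Ω x ∈ S) : ∃ l : V →ₗ[𝕜] W, ∀ x, Ω x - l x ∈ S := by
  obtain ⟨r, hr⟩ := S.mkQ.exists_rightInverse_of_surjective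
    (LinearMap.range_eq_top.2 S.mkQ_surjective)
  let q : V →ₗ[𝕜] W ⧸ S :=
    { toFun := fun x => S.mkQ (Ω x)
      map_add' := fun x y => by
        rw [← map_add]
        exact (Submodule.Quotient.eq S).2 (hadd x y)
      map_smul' := fun a x => by
        rw [RingHom.id_apply, ← map_smul]
        exact (Submodule.Quotient.eq S).2 (hsmul a x) }
  exact ⟨r ∘ₗ q, fun x => (Submodule.Quotient.eq S).1 (LinearMap.congr_fun hr (q x)).symm⟩

/-- The square-summable families. -/
def squareSummable (𝕜 : Type*) [RCLike 𝕜] (κ : Type*) : Submodule 𝕜 (κ → 𝕜) where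
  carrier := {d | Memℓp d 2}
  add_mem' := fun h k => h.add k
  zero_mem' := zero_memℓp
  smul_mem' := fun c _ h => h.const_smul c

lemma mem_squareSummable_of_forall {d : κ → 𝕜} {C : ℝ}
    (h : ∀ (s : Finset κ) (z : κ → 𝕜), ∑ k ∈ s, ‖z k‖ ^ 2 ≤ 1 → ‖∑ k ∈ s, z k * d k‖ ≤ C) :
    d ∈ squareSummable 𝕜 κ :=
  memℓp_gen' (C := C ^ 2) fun s => by simpa using sum_norm_sq_le_of_forall (h s)

lemma kaltonPeck_smul (a : 𝕜) (c : lp (fun _ : κ => 𝕜) 2) :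
    kaltonPeck (a • c) = a • kaltonPeck c := by
  rcases eq_or_ne a 0 with rfl | ha
  · simp [kaltonPeck_zero]
  ext k
  simp only [kaltonPeck, lp.coeFn_smul, Pi.smul_apply, smul_eq_mul, norm_smul, norm_mul]
  rw [mul_div_mul_left _ _ (norm_ne_zero_iff.2 ha)]
  ring

/-- After pairing with `z`, each of the three terms is close to the same linear functional of its
argument. Those linear parts cancel, leaving a bound independent of `z`. -/
lemma kaltonPeck_add_sub_mem (c d : lp (fun _ : κ => 𝕜) 2) :
    kaltonPeck (c + d) - (kaltonPeck c + kaltonPeck d) ∈ squareSummable 𝕜 κ := by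
  refine mem_squareSummable_of_forall (C := 2 * ‖c + d‖ + (2 * ‖c‖ + 2 * ‖d‖)) fun s z hz => ?_
  have e : ∑ k ∈ s, z k * (kaltonPeck (c + d) - (kaltonPeck c + kaltonPeck d)) k =
      (∑ k ∈ s, z k * kaltonPeck (c + d) k - ∑ k ∈ s, z k * Real.log ‖z k‖ * (c + d) k) -
      ((∑ k ∈ s, z k * kaltonPeck c k - ∑ k ∈ s, z k * Real.log ‖z k‖ * c k) +
      (∑ k ∈ s, z k * kaltonPeck d k - ∑ k ∈ s, z k * Real.log ‖z k‖ * d k)) := by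
    simp only [← Finset.sum_sub_distrib, ← Finset.sum_add_distrib]
    refine Finset.sum_congr rfl fun k _ => ?_
    simp only [Pi.sub_apply, Pi.add_apply, lp.coeFn_add]
    ring
  rw [e]
  exact norm_sub_le_of_le (norm_sum_mul_kaltonPeck_sub_le hz _)
    (norm_add_le_of_le (norm_sum_mul_kaltonPeck_sub_le hz _) (norm_sum_mul_kaltonPeck_sub_le hz _))

variable {E : Type u} [NormedAddCommGroup E] [NormedSpace 𝕜 E] [CompleteSpace E]
  {F : Type v} [NormedAddCommGroup F] [NormedSpace 𝕜 F] [CompleteSpace F]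

namespace BanachExtension

/-- The Kalton–Peck extension of `F` by `E ≅ ℓ₂(κ)`, pulled back along `P : F → ℓ₂(κ)`: modulo a
linear map, its twist is `kaltonPeck ∘ P`. -/
theorem exists_isTwist_kaltonPeck (e : E ≃L[𝕜] lp (fun _ : κ => 𝕜) 2)
    (P : F →L[𝕜] lp (fun _ : κ => 𝕜) 2) :
    ∃ (X : BanachExtension 𝕜 F E) (f : F → E) (l : F →ₗ[𝕜] κ → 𝕜), IsTwist X f ∧
      ∀ y, ⇑(e (f y)) = kaltonPeck (P y) - l y := by
  obtain ⟨l, hl⟩ := exists_linearMap_sub_mem (squareSummable 𝕜 κ) (fun y => kaltonPeck (P y))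
    (fun x y => by rw [map_add]; exact kaltonPeck_add_sub_mem _ _)
    (fun a x => by rw [map_smul, kaltonPeck_smul, sub_self]; exact zero_mem _)
  let f : F → E := fun y => e.symm ⟨kaltonPeck (P y) - l y, hl y⟩
  have hf : ∀ y, ⇑(e (f y)) = kaltonPeck (P y) - l y := fun y => by
    simp only [f, e.apply_symm_apply]
  let ι := {p : Finset κ × (κ → 𝕜) // ∑ k ∈ p.1, ‖p.2 k‖ ^ 2 ≤ 1}
  let z : ι → StrongDual 𝕜 E := fun p =>
    ∑ k ∈ p.1.1, p.1.2 k • (lp.evalCLM 𝕜 (fun _ : κ => 𝕜) 2 k).comp (e : E →L[𝕜] _)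
  have hz : ∀ p x, z p x = ∑ k ∈ p.1.1, p.1.2 k * e x k := fun p x => by
    simp only [z, _root_.sum_apply]
    rfl
  -- The linear functional approximating the pairing with the Kalton–Peck map, corrected by the
  -- linear map `l` subtracted in `f`.
  let ψ : ι → F →ₗ[𝕜] 𝕜 := fun p =>
    ∑ k ∈ p.1.1, ((p.1.2 k * Real.log ‖p.1.2 k‖) •
      ((lp.evalCLM 𝕜 (fun _ : κ => 𝕜) 2 k).comp P).toLinearMap -
        p.1.2 k • (LinearMap.proj k ∘ₗ l))
  have hψ : ∀ p y, ψ p y = ∑ k ∈ p.1.1,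
      (p.1.2 k * Real.log ‖p.1.2 k‖ * P y k - p.1.2 k * l y k) := fun p y => by
    simp only [ψ, LinearMap.sum_apply]
    rfl
  obtain ⟨X, hX⟩ := exists_isTwist_of_functionals f z ψ
    (K := ‖(e.symm : _ →L[𝕜] E)‖) (M := ‖(e : E →L[𝕜] lp (fun _ : κ => 𝕜) 2)‖) (C := 2 * ‖P‖)
    (fun p x => by
      rw [hz]
      exact (norm_sum_mul_le_norm_lp p.2 (e x)).trans
        ((e : E →L[𝕜] lp (fun _ : κ => 𝕜) 2).le_opNorm x))
    (fun x r hr h => by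
      have h1 : ‖e x‖ ≤ r := lp.norm_le_of_sum_norm_sq_le hr fun s =>
        sum_norm_sq_le_of_forall fun w hw => by
          simpa only [hz] using h ⟨(s, w), hw⟩
      have h2 := (e.symm : _ →L[𝕜] E).le_opNorm_of_le h1
      simpa using h2)
    (fun p y => by
      have e1 : z p (f y) - ψ p y = ∑ k ∈ p.1.1, p.1.2 k * kaltonPeck (P y) k -
          ∑ k ∈ p.1.1, p.1.2 k * Real.log ‖p.1.2 k‖ * P y k := by
        rw [hz, hψ, hf]
        simp only [← Finset.sum_sub_distrib]
        refine Finset.sum_congr rfl fun k _ => ?_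
        simp only [Pi.sub_apply]
        ring
      rw [e1, mul_assoc]
      exact (norm_sum_mul_kaltonPeck_sub_le p.2 (P y)).trans
        (mul_le_mul_of_nonneg_left (P.le_opNorm y) zero_le_two))
  exact ⟨X, f, l, hX, hf⟩

end BanachExtension

end KaltonPeck

/-! ### Coordinate restriction and extension operators on `ℓ₂`. -/

section Coordinates

variable {𝕜 : Type*} [RCLike 𝕜] {α β κ : Type*}

/-- A linear map of families that decreases finite sums of squares is an operator on `ℓ₂`. -/
noncomputable def lpMap (T : (α → 𝕜) →ₗ[𝕜] (β → 𝕜))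
    (hT : ∀ (x : α → 𝕜) (s : Finset β), ∃ t : Finset α,
      ∑ k ∈ s, ‖T x k‖ ^ 2 ≤ ∑ k ∈ t, ‖x k‖ ^ 2) :
    lp (fun _ : α => 𝕜) 2 →L[𝕜] lp (fun _ : β => 𝕜) 2 :=
  have hT' : ∀ (x : lp (fun _ : α => 𝕜) 2) (s : Finset β),
      ∑ k ∈ s, ‖T x k‖ ^ 2 ≤ ‖x‖ ^ 2 := fun x s => by
    obtain ⟨t, ht⟩ := hT x s
    exact ht.trans (lp.sum_norm_sq_le x t)
  LinearMap.mkContinuous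
    { toFun := fun x => ⟨T x, memℓp_gen' (C := ‖x‖ ^ 2) fun s => by simpa using hT' x s⟩
      map_add' := fun x y => lp.ext (T.map_add x y)
      map_smul' := fun c x => lp.ext (T.map_smul c x) } 1
    fun x => by
      rw [one_mul]
      exact lp.norm_le_of_sum_norm_sq_le (norm_nonneg x) (hT' x)

lemma norm_lpMap_le (T : (α → 𝕜) →ₗ[𝕜] (β → 𝕜)) (hT) (x : lp (fun _ : α => 𝕜) 2) :
    ‖lpMap T hT x‖ ≤ ‖x‖ :=
  lp.norm_le_of_sum_norm_sq_le (norm_nonneg x) fun s => by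
    obtain ⟨t, ht⟩ := hT x s
    exact ht.trans (lp.sum_norm_sq_le x t)

/-- The operator `x ↦ x ∘ g`. -/
noncomputable def lpComap (𝕜 : Type*) [RCLike 𝕜] (g : α ↪ β) :
    lp (fun _ : β => 𝕜) 2 →L[𝕜] lp (fun _ : α => 𝕜) 2 :=
  lpMap (LinearMap.funLeft 𝕜 𝕜 g) fun x s => ⟨s.map g, by simp [LinearMap.funLeft]⟩

/-- The operator that extends a family by zero along `g`. -/
noncomputable def lpExtend (𝕜 : Type*) [RCLike 𝕜] (g : α ↪ β) :
    lp (fun _ : α => 𝕜) 2 →L[𝕜] lp (fun _ : β => 𝕜) 2 :=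
  lpMap (Function.ExtendByZero.linearMap 𝕜 g) fun x s => by
    refine ⟨s.preimage g g.injective.injOn, le_of_eq ?_⟩
    rw [← Finset.sum_preimage g s g.injective.injOn]
    · simp [g.injective.extend_apply]
    · intro k _ hk
      simp [Function.extend_apply' _ _ _ hk]

lemma lpExtend_apply (g : α ↪ β) (x : lp (fun _ : α => 𝕜) 2) (k : α) :
    lpExtend 𝕜 g x (g k) = x k :=
  g.injective.extend_apply _ _ k

lemma lpExtend_apply_of_notMem (g : α ↪ β) (x : lp (fun _ : α => 𝕜) 2) {k : β}
    (hk : k ∉ Set.range g) : lpExtend 𝕜 g x k = 0 :=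
  Function.extend_apply' _ _ _ hk

lemma lpComap_lpExtend (g : α ↪ β) (x : lp (fun _ : α => 𝕜) 2) :
    lpComap 𝕜 g (lpExtend 𝕜 g x) = x :=
  lp.ext (funext fun k => lpExtend_apply g x k)

lemma lpComap_lpExtend_of_disjoint {α' : Type*} (g : α ↪ β) (g' : α' ↪ β)
    (h : ∀ k k', g k ≠ g' k') (x : lp (fun _ : α' => 𝕜) 2) :
    lpComap 𝕜 g (lpExtend 𝕜 g' x) = 0 :=
  lp.ext (funext fun k => lpExtend_apply_of_notMem g' x (by
    rintro ⟨k', hk'⟩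
    exact h k k' hk'.symm))

lemma norm_lpExtend (g : α ↪ β) (x : lp (fun _ : α => 𝕜) 2) : ‖lpExtend 𝕜 g x‖ = ‖x‖ := by
  refine le_antisymm (norm_lpMap_le _ _ x) ?_
  conv_lhs => rw [← lpComap_lpExtend g x]
  exact norm_lpMap_le _ _ _

/-- `ℓ₂` is isomorphic to its square. -/
noncomputable def lpProdEquiv (𝕜 : Type*) [RCLike 𝕜] (a : ℕ ⊕ ℕ ≃ ℕ) :
    (lp (fun _ : ℕ => 𝕜) 2 × lp (fun _ : ℕ => 𝕜) 2) ≃L[𝕜] lp (fun _ : ℕ => 𝕜) 2 :=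
  let g : ℕ ↪ ℕ := Function.Embedding.inl.trans a.toEmbedding
  let h : ℕ ↪ ℕ := Function.Embedding.inr.trans a.toEmbedding
  have hgh : ∀ m n, g m ≠ h n := fun m n e => Sum.inl_ne_inr (a.injective e)
  ContinuousLinearEquiv.equivOfInverse ((lpExtend 𝕜 g).coprod (lpExtend 𝕜 h))
    ((lpComap 𝕜 g).prod (lpComap 𝕜 h))
    (fun x => by
      refine Prod.ext ?_ ?_
      · change lpComap 𝕜 g (lpExtend 𝕜 g x.1 + lpExtend 𝕜 h x.2) = x.1
        rw [map_add, lpComap_lpExtend, lpComap_lpExtend_of_disjoint _ _ hgh, add_zero]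
      · change lpComap 𝕜 h (lpExtend 𝕜 g x.1 + lpExtend 𝕜 h x.2) = x.2
        rw [map_add, lpComap_lpExtend, lpComap_lpExtend_of_disjoint _ _ fun m n => (hgh n m).symm,
          zero_add])
    (fun x => by
      refine lp.ext (funext fun k => ?_)
      change lpExtend 𝕜 g (lpComap 𝕜 g x) k + lpExtend 𝕜 h (lpComap 𝕜 h x) k = x k
      obtain ⟨m | m, rfl⟩ := a.surjective k
      · rw [lpExtend_apply_of_notMem h _ (by rintro ⟨n, hn⟩; exact hgh m n hn.symm), add_zero]
        exact lpExtend_apply g _ m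
      · rw [lpExtend_apply_of_notMem g _ (by rintro ⟨n, hn⟩; exact hgh n m hn), zero_add]
        exact lpExtend_apply h _ m)

end Coordinates

/-! ### The Kalton–Peck map is not linear plus bounded. -/

section Nontriviality

variable {𝕜 : Type*} [RCLike 𝕜] {κ : Type*}

/-- Type 2 with constant one: the signs are chosen one at a time, so that the real part of the inner
product of each new term with the partial sum is nonpositive. -/
lemma exists_signs_norm_sq_sum_le {H : Type*} [NormedAddCommGroup H] [InnerProductSpace 𝕜 H]
    (v : ℕ → H) (n : ℕ) : ∃ ε : ℕ → 𝕜, (∀ i, ‖ε i‖ = 1) ∧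
      ‖∑ i ∈ Finset.range n, ε i • v i‖ ^ 2 ≤ ∑ i ∈ Finset.range n, ‖v i‖ ^ 2 := by
  induction n with
  | zero => exact ⟨1, by simp, by simp⟩
  | succ n ih =>
    obtain ⟨ε, hε, h⟩ := ih
    set S := ∑ i ∈ Finset.range n, ε i • v i
    obtain ⟨δ, hδ, hle⟩ : ∃ δ : 𝕜, ‖δ‖ = 1 ∧ ‖S + δ • v n‖ ^ 2 ≤ ‖S‖ ^ 2 + ‖v n‖ ^ 2 := by
      have h₁ := norm_add_sq (𝕜 := 𝕜) S (v n)
      have h₂ := norm_sub_sq (𝕜 := 𝕜) S (v n)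
      rcases le_total (RCLike.re (inner 𝕜 S (v n))) 0 with h0 | h0
      · refine ⟨1, by simp, ?_⟩
        rw [one_smul, h₁]
        linarith
      · refine ⟨-1, by simp, ?_⟩
        rw [neg_one_smul, ← sub_eq_add_neg, h₂]
        linarith
    refine ⟨Function.update ε n δ, fun i => ?_, ?_⟩
    · rcases eq_or_ne i n with rfl | hi
      · rwa [Function.update_self]
      · rw [Function.update_of_ne hi, hε]
    · rw [Finset.sum_range_succ, Finset.sum_range_succ, Function.update_self]
      have : ∑ i ∈ Finset.range n, Function.update ε n δ i • v i = S :=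
        Finset.sum_congr rfl fun i hi => by
          rw [Function.update_of_ne (Finset.mem_range.1 hi).ne]
      rw [this]
      linarith

/-- On the support the logarithm has the constant value `-log ‖c‖`, and off the support both sides
vanish. -/
lemma kaltonPeck_of_flat {c : lp (fun _ : κ => 𝕜) 2} (hc : ∀ k, c k = 0 ∨ ‖c k‖ = 1) :
    kaltonPeck c = (-Real.log ‖c‖ : 𝕜) • ⇑c := by
  ext k
  rcases hc k with h | h <;> simp [kaltonPeck, h]

/-- The Kalton–Peck map is not the sum of a linear map and a bounded map. -/
theorem eq_zero_of_smul_kaltonPeck_sub_bounded (h : ℕ ↪ κ) {a : 𝕜}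
    (G : lp (fun _ : ℕ => 𝕜) 2 → lp (fun _ : κ => 𝕜) 2)
    (L : lp (fun _ : ℕ => 𝕜) 2 →ₗ[𝕜] κ → 𝕜) {C : ℝ} (hC : ∀ x, ‖G x‖ ≤ C * ‖x‖)
    (hG : ∀ x, ⇑(G x) = a • kaltonPeck (lpExtend 𝕜 h x) - L x) : a = 0 := by
  let b : ℕ → lp (fun _ : ℕ => 𝕜) 2 := fun i => lp.single 2 i 1
  have hb : ∀ i, ‖b i‖ = 1 := fun i => by simp [b, lp.norm_single]
  have hflat : ∀ (ε : ℕ → 𝕜), (∀ i, ‖ε i‖ = 1) → ∀ n k,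
      lpExtend 𝕜 h (∑ i ∈ Finset.range n, ε i • b i) k = 0 ∨
        ‖lpExtend 𝕜 h (∑ i ∈ Finset.range n, ε i • b i) k‖ = 1 := by
    intro ε hε n k
    by_cases hk : k ∈ Set.range h
    · obtain ⟨m, rfl⟩ := hk
      rw [lpExtend_apply]
      have : (∑ i ∈ Finset.range n, ε i • b i : lp (fun _ : ℕ => 𝕜) 2) m =
          if m ∈ Finset.range n then ε m else 0 := by
        rw [lp.coeFn_sum, Finset.sum_apply]
        simp [b, Pi.single_apply]
      rw [this]
      split_ifs
      · exact Or.inr (hε m)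
      · exact Or.inl rfl
    · exact Or.inl (lpExtend_apply_of_notMem h _ hk)
  have hnorm : ∀ (ε : ℕ → 𝕜), (∀ i, ‖ε i‖ = 1) → ∀ n,
      ‖∑ i ∈ Finset.range n, ε i • b i‖ = √n := by
    intro ε hε n
    have h1 := lp.norm_sum_single (E := fun _ : ℕ => 𝕜) (p := 2) (by simp) ε (Finset.range n)
    have h2 : ∀ i, ε i • b i = lp.single 2 i (ε i) := fun i => by
      rw [← lp.single_smul, smul_eq_mul, mul_one]
    simp only [h2]
    refine (Real.sqrt_eq_iff_mul_self_eq (Nat.cast_nonneg n) (norm_nonneg _)).2 ?_ |>.symm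
    rw [← sq]
    simpa [hε] using h1.symm
  have hsingle : ∀ i, kaltonPeck (lpExtend 𝕜 h (b i)) = 0 := by
    intro i
    rw [kaltonPeck_of_flat, norm_lpExtend, hb]
    · simp
    · intro k
      by_cases hk : k ∈ Set.range h
      · obtain ⟨m, rfl⟩ := hk
        rw [lpExtend_apply]
        rcases eq_or_ne m i with rfl | hm
        · simp [b]
        · simp [b, hm]
      · exact Or.inl (lpExtend_apply_of_notMem h _ hk)
  have hLb : ∀ i, L (b i) = -⇑(G (b i)) := fun i => by
    rw [hG, hsingle, smul_zero, zero_sub, neg_neg]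
  have hC0 : 0 ≤ C := by
    have := (norm_nonneg _).trans (hC (b 0))
    rwa [hb, mul_one] at this
  -- With `x` the signed sum of `n` basis vectors, `w = -L x` by linearity, so `a log √n` times the
  -- extension of `x` equals `w - G x`. The left side has norm `|a| log √n · √n`, and `w` and `G x`
  -- have norm at most `C √n` each.
  have key : ∀ n : ℕ, 1 ≤ n → ‖a‖ * Real.log √n ≤ 2 * C := by
    intro n hn
    obtain ⟨ε, hε, hle⟩ := exists_signs_norm_sq_sum_le (𝕜 := 𝕜) (fun i => G (b i)) n
    set x := ∑ i ∈ Finset.range n, ε i • b i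
    set w := ∑ i ∈ Finset.range n, ε i • G (b i)
    have hx : ‖x‖ = √n := hnorm ε hε n
    have hpos : 0 < √(n : ℝ) := Real.sqrt_pos.2 (by exact_mod_cast hn)
    have hlog : 0 ≤ Real.log √n :=
      Real.log_nonneg (Real.one_le_sqrt.2 (by exact_mod_cast hn))
    have hw : ‖w‖ ≤ C * √n := by
      refine abs_le_of_sq_le_sq' ?_ (by positivity) |>.2
      refine hle.trans ?_
      rw [mul_pow, Real.sq_sqrt (Nat.cast_nonneg n)]
      calc ∑ i ∈ Finset.range n, ‖G (b i)‖ ^ 2 ≤ ∑ i ∈ Finset.range n, C ^ 2 :=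
            Finset.sum_le_sum fun i _ => pow_le_pow_left₀ (norm_nonneg _)
              ((hC (b i)).trans (by rw [hb, mul_one])) 2
        _ = C ^ 2 * n := by simp [mul_comm]
    have e : (a * Real.log √n) • lpExtend 𝕜 h x = w - G x := by
      refine lp.ext ?_
      have hwc : ⇑w = -L x := by
        simp only [w, x, map_sum, map_smul, hLb, lp.coeFn_sum, lp.coeFn_smul, smul_neg,
          Finset.sum_neg_distrib, neg_neg]
      rw [lp.coeFn_smul, lp.coeFn_sub, hwc, hG, kaltonPeck_of_flat (hflat ε hε n),
        norm_lpExtend, hx, smul_smul]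
      ext k
      simp only [Pi.sub_apply, Pi.neg_apply, Pi.smul_apply, smul_eq_mul]
      ring
    have h3 := congrArg norm e
    rw [norm_smul, norm_mul, RCLike.norm_ofReal, abs_of_nonneg hlog, norm_lpExtend, hx] at h3
    have h4 : ‖w - G x‖ ≤ C * √n + C * √n := norm_sub_le_of_le hw ((hC x).trans (by rw [hx]))
    rw [← h3] at h4
    refine le_of_mul_le_mul_right (h4.trans_eq (by ring)) hpos
  by_contra ha
  have hlim : Tendsto (fun n : ℕ => ‖a‖ * Real.log √n) atTop atTop :=
    (Real.tendsto_log_atTop.comp (Real.tendsto_sqrt_atTop.comp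
      tendsto_natCast_atTop_atTop)).const_mul_atTop (norm_pos_iff.2 ha)
  obtain ⟨n, hn, hn'⟩ := ((hlim.eventually_gt_atTop (2 * C)).and (eventually_ge_atTop 1)).exists
  exact absurd (key n hn') (not_le.2 hn)

end Nontriviality

/-! ### Linear independence and the main theorem. -/

section Main

variable {𝕜 : Type*} [RCLike 𝕜]
  {E : Type u} [NormedAddCommGroup E] [NormedSpace 𝕜 E]
  {F : Type v} [NormedAddCommGroup F] [NormedSpace 𝕜 F]

open BanachExtension

/-- Baer sums and scalar push-outs act on twists as pointwise sums and multiples, so linear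
relations in `Ext1` can be read off from twists. -/
lemma Ext1.exists_isTwist_sum_smul [CompleteSpace E] [CompleteSpace F] {ι : Type*}
    {X : ι → BanachExtension 𝕜 F E} {f : ι → F → E} (hX : ∀ j, IsTwist (X j) (f j))
    (s : Finset ι) (c : ι → 𝕜) :
    ∃ Y, IsTwist Y (∑ j ∈ s, c j • f j) ∧ ∑ j ∈ s, c j • Ext1.mk (X j) = Ext1.mk Y := by
  classical
  induction s using Finset.induction_on with
  | empty => exact ⟨split 𝕜 F E, by simpa using isTwist_split, by simp; rfl⟩
  | insert j s hj ih =>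
    obtain ⟨Y, hY, hsum⟩ := ih
    rw [Finset.sum_insert hj, Finset.sum_insert hj, hsum, Ext1.smul_mk, Ext1.mk_add_mk]
    exact ⟨_, ((hX j).smul (c j)).baerSum hY, rfl⟩

/-- Extensions are linearly independent if their twists are so modulo the trivial twists. -/
lemma Ext1.linearIndependent_mk [CompleteSpace E] [CompleteSpace F] {ι : Type*}
    {X : ι → BanachExtension 𝕜 F E} {f : ι → F → E} (hX : ∀ j, IsTwist (X j) (f j))
    (h : ∀ (s : Finset ι) (c : ι → 𝕜), ∑ j ∈ s, c j • f j ∈ trivialTwists 𝕜 F E →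
      ∀ j ∈ s, c j = 0) : LinearIndependent 𝕜 fun j => Ext1.mk (X j) := by
  refine linearIndependent_iff'.2 fun s c hc => h s c ?_
  obtain ⟨Y, hY, hsum⟩ := exists_isTwist_sum_smul hX s c
  have h0 : Ext1.mk Y = Ext1.mk (split 𝕜 F E) := hsum.symm.trans hc
  simpa using (congruent_iff hY isTwist_split).1 (Quotient.exact h0)

theorem not_finiteDimensional_ext1 [CompleteSpace E] [CompleteSpace F] {κ κ' : Type*}
    [Infinite κ] [Infinite κ'] (e : E ≃L[𝕜] lp (fun _ : κ => 𝕜) 2)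
    (e' : F ≃L[𝕜] lp (fun _ : κ' => 𝕜) 2) : ¬ FiniteDimensional 𝕜 (Ext1 𝕜 F E) := by
  let h : ℕ ↪ κ := Infinite.natEmbedding κ
  -- The rows of `ℕ × ℕ` become infinitely many disjoint infinite blocks of `κ'`. `P j` reads the
  -- block `j` and `J j` fills it, so `P k` annihilates the range of `J j` for `k ≠ j`.
  let g₀ : ℕ × ℕ ↪ κ' := Nat.pairEquiv.toEmbedding.trans (Infinite.natEmbedding κ')
  let g : ℕ → ℕ ↪ κ' := fun j => (Function.Embedding.sectR j ℕ).trans g₀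
  have hg : ∀ {j k}, j ≠ k → ∀ m n, g j m ≠ g k n := fun hjk m n heq =>
    hjk (congrArg Prod.fst (g₀.injective heq))
  let P : ℕ → F →L[𝕜] lp (fun _ : κ => 𝕜) 2 := fun j =>
    (lpExtend 𝕜 h).comp ((lpComap 𝕜 (g j)).comp (e' : F →L[𝕜] lp (fun _ : κ' => 𝕜) 2))
  let J : ℕ → lp (fun _ : ℕ => 𝕜) 2 →L[𝕜] F := fun j =>
    (e'.symm : lp (fun _ : κ' => 𝕜) 2 →L[𝕜] F).comp (lpExtend 𝕜 (g j))
  have hPJ : ∀ j k x, P j (J k x) = lpExtend 𝕜 h (lpComap 𝕜 (g j) (lpExtend 𝕜 (g k) x)) :=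
    fun j k x => congrArg (fun y => lpExtend 𝕜 h (lpComap 𝕜 (g j) y)) (e'.apply_symm_apply _)
  have hPJ₁ : ∀ j x, P j (J j x) = lpExtend 𝕜 h x := fun j x => by
    rw [hPJ, lpComap_lpExtend]
  have hPJ₂ : ∀ j k x, k ≠ j → P k (J j x) = 0 := fun j k x hkj => by
    rw [hPJ, lpComap_lpExtend_of_disjoint _ _ (hg hkj), map_zero]
  choose X f l hX hf using fun j => exists_isTwist_kaltonPeck e (P j)
  have hind : LinearIndependent 𝕜 fun j => Ext1.mk (X j) := by
    refine Ext1.linearIndependent_mk hX fun s c hs j hj => ?_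
    obtain ⟨m, C, hC⟩ := hs
    let coord : E →ₗ[𝕜] κ → 𝕜 := LinearMap.pi fun k =>
      ((lp.evalCLM 𝕜 (fun _ : κ => 𝕜) 2 k).comp
        (e : E →L[𝕜] lp (fun _ : κ => 𝕜) 2)).toLinearMap
    have hcoord : ∀ x, coord x = ⇑(e x) := fun x => rfl
    -- All linear parts together: the corrections `l k` and the linear part `m` of the trivial
    -- twist. Along `J j` what remains of the combination is `c j` times the Kalton–Peck map.
    let L : F →ₗ[𝕜] κ → 𝕜 := ∑ k ∈ s, c k • l k + coord ∘ₗ m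
    let G : F → E := fun y => (∑ k ∈ s, c k • f k) y - m y
    refine eq_zero_of_smul_kaltonPeck_sub_bounded h (fun x => e (G (J j x)))
      (L ∘ₗ (J j).toLinearMap)
      (C := ‖(e : E →L[𝕜] lp (fun _ : κ => 𝕜) 2)‖ * (|C| * ‖J j‖)) (fun x => ?_) fun x => ?_
    · rw [mul_assoc]
      refine (e : E →L[𝕜] lp (fun _ : κ => 𝕜) 2).le_opNorm_of_le ((hC (J j x)).trans ?_)
      rw [mul_assoc]
      exact mul_le_mul (le_abs_self C) ((J j).le_opNorm x) (norm_nonneg _) (abs_nonneg C)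
    · have h1 : coord ((∑ k ∈ s, c k • f k) (J j x)) =
          ∑ k ∈ s, c k • (kaltonPeck (P k (J j x)) - l k (J j x)) := by
        rw [Finset.sum_apply, map_sum]
        refine Finset.sum_congr rfl fun k _ => ?_
        rw [Pi.smul_apply, map_smul, hcoord, hf]
      have h2 : ∑ k ∈ s, c k • kaltonPeck (P k (J j x)) =
          c j • kaltonPeck (lpExtend 𝕜 h x) := by
        rw [Finset.sum_eq_single_of_mem j hj, hPJ₁]
        intro k _ hkj
        rw [hPJ₂ j k x hkj, kaltonPeck_zero, smul_zero]
      change coord (G (J j x)) = _ - L (J j x)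
      simp only [G, L, map_sub, h1, smul_sub, Finset.sum_sub_distrib, h2, LinearMap.add_apply,
        LinearMap.sum_apply, LinearMap.smul_apply, LinearMap.comp_apply]
      abel
  intro _
  exact Infinite.not_finite (α := ℕ) hind.finite

lemma infinite_of_equiv_lp {κ : Type*} (e : E ≃L[𝕜] lp (fun _ : κ => 𝕜) 2)
    (hE : ¬ FiniteDimensional 𝕜 E) : Infinite κ := by
  refine not_finite_iff_infinite.1 fun _ => hE ?_
  have := Fintype.ofFinite κ
  let T : E →ₗ[𝕜] κ → 𝕜 := LinearMap.pi fun k =>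
    ((lp.evalCLM 𝕜 (fun _ : κ => 𝕜) 2 k).comp
      (e : E →L[𝕜] lp (fun _ : κ => 𝕜) 2)).toLinearMap
  exact FiniteDimensional.of_injective T fun x y hxy => e.injective (lp.ext hxy)

lemma not_finiteDimensional_of_equiv_lp (e : E ≃L[𝕜] lp (fun _ : ℕ => 𝕜) 2) :
    ¬ FiniteDimensional 𝕜 E := by
  intro _
  have hind : LinearIndependent 𝕜 fun i : ℕ => e.symm (lp.single 2 i (1 : 𝕜)) := by
    refine linearIndependent_iff'.2 fun s c hc j hj => ?_
    have h1 : ∑ i ∈ s, c i • lp.single (E := fun _ : ℕ => 𝕜) 2 i (1 : 𝕜) = 0 := by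
      simpa using congrArg e hc
    have h2 : (∑ i ∈ s, c i • lp.single (E := fun _ : ℕ => 𝕜) 2 i (1 : 𝕜)) j = 0 := by
      rw [h1]
      rfl
    rw [lp.coeFn_sum, Finset.sum_apply] at h2
    simpa [Pi.single_apply, hj] using h2
  exact Infinite.not_finite (α := ℕ) hind.finite

/-- Every finite-dimensional subspace serves as its own `B`: its image in `H` is Euclidean, and the
distortion is at most that of `e`. -/
lemma isScriptLpSpace_two_of_equiv {H : Type*} [NormedAddCommGroup H] [InnerProductSpace 𝕜 H]
    (e : E ≃L[𝕜] H) : IsScriptLpSpace 𝕜 E 2 := by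
  refine ⟨‖(e : E →L[𝕜] H)‖ * ‖(e.symm : H →L[𝕜] E)‖, fun A _ => ⟨A, le_rfl, ?_⟩⟩
  let A' := A.map (e : E →ₗ[𝕜] H)
  let b := (stdOrthonormalBasis 𝕜 A').repr
  let T : A ≃L[𝕜] EuclideanSpace 𝕜 (Fin (Module.finrank 𝕜 A')) :=
    (e.submoduleMap A).trans b.toContinuousLinearEquiv
  refine ⟨_, T, mul_le_mul ?_ ?_ (norm_nonneg _) (norm_nonneg _)⟩
  · refine ContinuousLinearMap.opNorm_le_bound _ (norm_nonneg _) fun x => ?_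
    change ‖b (e.submoduleMap A x)‖ ≤ _
    rw [b.norm_map]
    exact (e : E →L[𝕜] H).le_opNorm x
  · refine ContinuousLinearMap.opNorm_le_bound _ (norm_nonneg _) fun x => ?_
    change ‖(e.submoduleMap A).symm (b.symm x)‖ ≤ _
    rw [← b.symm.norm_map x]
    exact (e.symm : H →L[𝕜] E).le_opNorm (b.symm x : A')

end Main

theorem mainTheorem6 {𝕜 : Type*} [RCLike 𝕜]
    (E : Type u) [NormedAddCommGroup E] [NormedSpace 𝕜 E] [CompleteSpace E]
    (F : Type v) [NormedAddCommGroup F] [NormedSpace 𝕜 F] [CompleteSpace F] :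
    (¬ FiniteDimensional 𝕜 E → ¬ FiniteDimensional 𝕜 F →
      IsScriptLpSpace 𝕜 E 2 → IsScriptLpSpace 𝕜 F 2 →
      ZeroOrInfiniteHypothesis 𝕜 E F →
      ¬ FiniteDimensional 𝕜 (Ext1 𝕜 F E)) ∧
    (Nonempty (E ≃L[𝕜] lp (fun _ : ℕ => 𝕜) 2) → Nonempty (F ≃L[𝕜] lp (fun _ : ℕ => 𝕜) 2) →
      (¬ FiniteDimensional 𝕜 E ∧ ¬ FiniteDimensional 𝕜 F ∧
        IsScriptLpSpace 𝕜 E 2 ∧ IsScriptLpSpace 𝕜 F 2 ∧ ZeroOrInfiniteHypothesis 𝕜 E F) ∧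
      ¬ FiniteDimensional 𝕜 (Ext1 𝕜 F E)) := by
  constructor
  · intro hE hF h2E h2F _
    obtain ⟨κ, ⟨e⟩⟩ := h2E.exists_equiv_lp
    obtain ⟨κ', ⟨e'⟩⟩ := h2F.exists_equiv_lp
    have := infinite_of_equiv_lp e hE
    have := infinite_of_equiv_lp e' hF
    exact not_finiteDimensional_ext1 e e'
  · rintro ⟨e⟩ ⟨e'⟩
    exact ⟨⟨not_finiteDimensional_of_equiv_lp e, not_finiteDimensional_of_equiv_lp e',
      isScriptLpSpace_two_of_equiv e, isScriptLpSpace_two_of_equiv e',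
      -- The condition met here is `E ⊕ E ≅ E`, transported from `ℓ₂ ⊕ ℓ₂ ≅ ℓ₂`.
      Or.inr (Or.inr (Or.inl ⟨(e.prodCongr e).trans
        ((lpProdEquiv 𝕜 Equiv.natSumNatEquivNat).trans e.symm)⟩))⟩,
      not_finiteDimensional_ext1 e e'⟩
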